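/- Let $(M,L)$ be a Finsler manifold of dimension $n\ge 3$: $M$ is a smooth manifold and $L:TM\to\mathbb R$ is continuous, smooth and positive on the bundle $\mathcal TM$ of nonzero tangent vectors, positively homogeneous of degree $1$ in the directional argument $y$, and the Finsler metric $g_{ij}=\frac12\,\partial^2L^2/\partial y^i\partial y^j$ is positive definite on $\mathcal TM$. Let $\nabla$ be the Cartan connection on the pullback bundle $\pi^{-1}(TM)$ over $\mathcal TM$, with horizontal map $\beta$; let $\stackrel{h}{\nabla}$ denote $h$-covariant differentiation, $(\stackrel{h}{\nabla}T)(U,\dots)=(\nabla_{\beta U}T)(\dots)$, and $$R(X,Y)Z=-\nabla_{\beta X}\nabla_{\beta Y}Z+\nabla_{\beta Y}\nabla_{\beta X}Z+\nabla_{[\beta X,\beta Y]}Z$$ the $h$-curvature tensor. Put $\mathbf R(X,Y,Z,W)=g(R(X,Y)Z,W)$, $\mathrm{Ric}(X,Z)=\mathrm{tr}\{Y\mapsto R(X,Y)Z\}$, $r=\mathrm{tr}_g\,\mathrm{Ric}$ (a function on $\mathcal TM$), $\mathbf G(X,Y,Z,W)=g(X,Z)g(Y,W)-g(Y,Z)g(X,W)$,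 $$(g\wedge \mathrm{Ric})(X,Y,Z,W)=g(X,Z)\mathrm{Ric}(Y,W)+g(Y,W)\mathrm{Ric}(X,Z)-g(X,W)\mathrm{Ric}(Y,Z)-g(Y,Z)\mathrm{Ric}(X,W),$$ and let $\mathbb C=\mathbf R-\frac1{n-2}\,g\wedge\mathrm{Ric}$ be the conharmonic curvature tensor. A scalar $1$-form here is a smooth section over $\mathcal TM$ of the dual of $\pi^{-1}(TM)$; a form or tensor is called nonzero if it does not vanish identically on $\mathcal TM$. Suppose that $R$ is nonzero and that $(M,L)$ is hyper-generalized recurrent ($HGF_n$) with recurrence forms $A,B$, that is, $A$ and $B$ are nonzero scalar $1$-forms and $$\stackrel{h}{\nabla}\mathbf R=A\otimes\mathbf R+B\otimes(g\wedge\mathrm{Ric}).$$ (The manifold may or may not be horizontally integrable.) (a) If $r$ vanishes nowhere on $\mathcal TM$, then $(M,L)$ is generalized conharmonically recurrent: there are nonzero scalar $1$-forms $A',B'$, positively homogeneous of degree $0$ in $y$, with $\stackrel{h}{\nabla}\mathbb C=A'\otimes\mathbb C+B'\otimes\mathbf G$. Moreover, with the given form $A$ itself, $\stackrel{h}{\nabla}\mathbb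 C=A\otimes\mathbb C+B''\otimes\mathbf G$ for some scalar $1$-form $B''$ that has the same zeros as $B$ and is positively homogeneous of degree $0$ if $B$ is. (b) If $r=0$ on $\mathcal TM$, then $(M,L)$ is conharmonically recurrent: there is a nonzero scalar $1$-form $A'$, positively homogeneous of degree $0$ in $y$, with $\stackrel{h}{\nabla}\mathbb C=A'\otimes\mathbb C$. Moreover $\stackrel{h}{\nabla}\mathbb C=A\otimes\mathbb C$ for the given form $A$. -/

import Mathlib

open scoped Manifold ContDiff

noncomputable section

/-! ## Finsler geometry on an open set of `E × E`

`E` is a finite-dimensional real vector space.  A point `z = (x, y)` of `E × E` is a tangent vector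
`y` at the point `x` of a coordinate domain, and `F z = L z ^ 2 / 2` is the energy of a fundamental
function `L`.  A `π`-tensor field is a function of `z`. -/

namespace FinslerLocal

variable {E : Type*} [NormedAddCommGroup E] [NormedSpace ℝ E]
variable {V : Type*} [NormedAddCommGroup V] [NormedSpace ℝ V]

/-- The partial derivative in the positional argument: `dPos f z u = uⁱ ∂f/∂xⁱ`. -/
def dPos (f : E × E → V) (z : E × E) : E →L[ℝ] V :=
  (fderiv ℝ f z).comp (ContinuousLinearMap.inl ℝ E E)

/-- The partial derivative in the directional argument: `dDir f z u = uⁱ ∂f/∂yⁱ`. -/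
def dDir (f : E × E → V) (z : E × E) : E →L[ℝ] V :=
  (fderiv ℝ f z).comp (ContinuousLinearMap.inr ℝ E E)

/-- The Finsler metric `g_ij = ∂²F/∂yⁱ∂yʲ`. -/
def metric (F : E × E → ℝ) (z : E × E) : E →L[ℝ] E →L[ℝ] ℝ :=
  dDir (dDir F) z

/-- Raising an index: `sharp F z α` is the vector `w` with `g(w, ·) = α`. -/
def sharp (F : E × E → ℝ) (z : E × E) : (E →L[ℝ] ℝ) →L[ℝ] E :=
  (metric F z).inverse

/-- The coefficients of the canonical (geodesic) spray,
`2 Gⁱ = gⁱʲ (yᵏ ∂²F/∂xᵏ∂yʲ - ∂F/∂xʲ)`. -/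
def spray (F : E × E → ℝ) (z : E × E) : E :=
  (1 / 2 : ℝ) • sharp F z (dPos (dDir F) z z.2 - dPos F z)

/-- The nonlinear (Barthel) connection of the Cartan connection, `Nⁱ_j = ∂Gⁱ/∂yʲ`. -/
def nonlin (F : E × E → ℝ) (z : E × E) : E →L[ℝ] E :=
  dDir (spray F) z

/-- The derivative along the horizontal lift `β u = uʲ (∂/∂xʲ - Nᵏ_j ∂/∂yᵏ)` of `u`. -/
def dHor (F : E × E → ℝ) (f : E × E → V) (z : E × E) : E →L[ℝ] V :=
  dPos f z - (dDir f z).comp (nonlin F z)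

/-- The cyclic rearrangement of a trilinear form: `rotate T u w l = T l u w`. -/
def rotate (T : E →L[ℝ] E →L[ℝ] E →L[ℝ] ℝ) : E →L[ℝ] E →L[ℝ] E →L[ℝ] ℝ :=
  ((ContinuousLinearMap.flipₗᵢ ℝ E E ℝ : (E →L[ℝ] E →L[ℝ] ℝ) ≃ₗᵢ[ℝ] (E →L[ℝ] E →L[ℝ] ℝ)) :
    (E →L[ℝ] E →L[ℝ] ℝ) →L[ℝ] (E →L[ℝ] E →L[ℝ] ℝ)).comp T.flip

/-- The horizontal coefficients of the Cartan connection,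
`Γⁱ_jk = ½ gⁱˡ (δ_j g_kl + δ_k g_jl - δ_l g_jk)`.  For a constant `w`, `∇_{βu} w = Γ(u, w)`. -/
def horCoeff (F : E × E → ℝ) (z : E × E) : E →L[ℝ] E →L[ℝ] E :=
  (1 / 2 : ℝ) • (ContinuousLinearMap.compL ℝ E (E →L[ℝ] ℝ) E (sharp F z)).comp
    (dHor F (metric F) z + (dHor F (metric F) z).flip - rotate (dHor F (metric F) z))

/-- The vertical coefficients of the Cartan connection, `Cⁱ_jk = ½ gⁱˡ ∂g_kl/∂yʲ`.
For a constant `w`, `∇_{γu} w = C(u, w)`. -/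
def vertCoeff (F : E × E → ℝ) (z : E × E) : E →L[ℝ] E →L[ℝ] E :=
  (1 / 2 : ℝ) • (ContinuousLinearMap.compL ℝ E (E →L[ℝ] ℝ) E (sharp F z)).comp
    (dDir (metric F) z)

/-- The curvature of the nonlinear connection: `[βu, βw] = - γ (nonlinCurv u w)` for constant
`u`, `w`, that is `(δ_j Nⁱ_k - δ_k Nⁱ_j) uʲ wᵏ`. -/
def nonlinCurv (F : E × E → ℝ) (z : E × E) : E →L[ℝ] E →L[ℝ] E :=
  dHor F (nonlin F) z - (dHor F (nonlin F) z).flip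

/-- The horizontal curvature tensor of the Cartan connection, with the sign convention
`R(X, Y) Z = - ∇_{βX} ∇_{βY} Z + ∇_{βY} ∇_{βX} Z + ∇_{[βX, βY]} Z`. -/
def hCurv (F : E × E → ℝ) (z : E × E) : E →L[ℝ] E →L[ℝ] E →L[ℝ] E :=
  -(dHor F (horCoeff F) z - (dHor F (horCoeff F) z).flip
    + (ContinuousLinearMap.compL ℝ E E E).bilinearComp (horCoeff F z) (horCoeff F z)
    - ((ContinuousLinearMap.compL ℝ E E E).bilinearComp (horCoeff F z) (horCoeff F z)).flip
    + (ContinuousLinearMap.compL ℝ E E (E →L[ℝ] E) (vertCoeff F z)).comp (nonlinCurv F z))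

/-- The trace of an endomorphism. -/
def endTrace [FiniteDimensional ℝ E] : (E →L[ℝ] E) →L[ℝ] ℝ :=
  LinearMap.toContinuousLinearMap
    ((LinearMap.trace ℝ E).comp (ContinuousLinearMap.coeLM ℝ : (E →L[ℝ] E) →ₗ[ℝ] (E →ₗ[ℝ] E)))

/-- The horizontal Ricci tensor: `Ric(X, Z)` is the trace of `Y ↦ R(X, Y) Z`. -/
def ricci [FiniteDimensional ℝ E] (F : E × E → ℝ) (z : E × E) : E →L[ℝ] E →L[ℝ] ℝ :=
  (ContinuousLinearMap.compL ℝ E (E →L[ℝ] E) ℝ endTrace).comp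
    (((ContinuousLinearMap.flipₗᵢ ℝ E E E : (E →L[ℝ] E →L[ℝ] E) ≃ₗᵢ[ℝ] (E →L[ℝ] E →L[ℝ] E)) :
      (E →L[ℝ] E →L[ℝ] E) →L[ℝ] (E →L[ℝ] E →L[ℝ] E)).comp (hCurv F z))

/-- The horizontal Ricci vector form `Ric_o`, `g(Ric_o X, Y) = Ric(X, Y)`. -/
def ricciForm [FiniteDimensional ℝ E] (F : E × E → ℝ) (z : E × E) : E →L[ℝ] E :=
  (sharp F z).comp (ricci F z)

/-- The horizontal scalar curvature, the trace of `Ric_o`. -/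
def scalarCurv [FiniteDimensional ℝ E] (F : E × E → ℝ) (z : E × E) : ℝ :=
  endTrace (ricciForm F z)

/-- The covariant horizontal curvature tensor `𝐑(X, Y, Z, W) = g(R(X, Y) Z, W)`. -/
def hCurv4 (F : E × E → ℝ) (z : E × E) (X Y Z W : E) : ℝ :=
  metric F z (hCurv F z X Y Z) W

/-- The tensor `𝐆(X, Y, Z, W) = g(g(X, Z) Y - g(Y, Z) X, W)`. -/
def tensorG (F : E × E → ℝ) (z : E × E) (X Y Z W : E) : ℝ :=
  metric F z (metric F z X Z • Y - metric F z Y Z • X) W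

/-- The Kulkarni-Nomizu product `g ∧ Ric`. -/
def kulkarniNomizu [FiniteDimensional ℝ E] (F : E × E → ℝ) (z : E × E) (X Y Z W : E) : ℝ :=
  metric F z X Z * ricci F z Y W + metric F z Y W * ricci F z X Z
    - metric F z X W * ricci F z Y Z - metric F z Y Z * ricci F z X W

/-- The conharmonic curvature tensor `ℂ = 𝐑 - (1 / (n - 2)) g ∧ Ric`, where `n = dim E`. -/
def conharmonic [FiniteDimensional ℝ E] (F : E × E → ℝ) (z : E × E) (X Y Z W : E) : ℝ :=
  hCurv4 F z X Y Z W
    - 1 / ((Module.finrank ℝ E : ℝ) - 2) * kulkarniNomizu F z X Y Z W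

/-- The `h`-covariant derivative `(∇_{βU} T)(X, Y, Z, W)` of a covariant `π`-tensor field `T` of
order four, with respect to the Cartan connection. -/
def hCov (F : E × E → ℝ) (T : E × E → E → E → E → E → ℝ) (z : E × E) (U X Y Z W : E) : ℝ :=
  dHor F (fun p => T p X Y Z W) z U
    - T z (horCoeff F z U X) Y Z W - T z X (horCoeff F z U Y) Z W
    - T z X Y (horCoeff F z U Z) W - T z X Y Z (horCoeff F z U W)

end FinslerLocal

/-! ## Finsler manifolds

`M` is a smooth manifold modelled on `E`, and the local constructions are applied to the energy
read in a chart of `TM`.  At a point `v = (x, y)` of `TM` the chart is the one induced by the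
preferred chart of `M` at `x`, in which the space `T_x M` of Mathlib is `E` itself.  All objects
are tensors, hence do not depend on the chart. -/

namespace Finsler

variable {E : Type*} [NormedAddCommGroup E] [NormedSpace ℝ E]
variable {M : Type*} [TopologicalSpace M] [ChartedSpace E M] [IsManifold 𝓘(ℝ, E) ∞ M]

/-- The coordinates `(x, y)` of the point `v` of `TM` in the chart at `v`. -/
def coords (v : TangentBundle 𝓘(ℝ, E) M) : E × E :=
  extChartAt 𝓘(ℝ, E).tangent v v

/-- The energy `L² / 2` read in the chart of `TM` at `v`. -/
def energy (L : TangentBundle 𝓘(ℝ, E) M → ℝ) (v : TangentBundle 𝓘(ℝ, E) M) : E × E → ℝ :=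
  fun z => L ((extChartAt 𝓘(ℝ, E).tangent v).symm z) ^ 2 / 2

/-- The Finsler metric, a positive definite form on `T_x M` for each nonzero `v ∈ T_x M`. -/
def metric (L : TangentBundle 𝓘(ℝ, E) M → ℝ) (v : TangentBundle 𝓘(ℝ, E) M)
    (X Y : TangentSpace 𝓘(ℝ, E) v.proj) : ℝ :=
  FinslerLocal.metric (energy L v) (coords v) X Y

/-- `(M, L)` is a Finsler manifold with fundamental function `L`. -/
structure IsFinsler (L : TangentBundle 𝓘(ℝ, E) M → ℝ) : Prop where
  continuous : Continuous L
  smooth : ∀ v : TangentBundle 𝓘(ℝ, E) M, v.snd ≠ 0 →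
    ContMDiffAt 𝓘(ℝ, E).tangent 𝓘(ℝ, ℝ) ∞ L v
  pos : ∀ v : TangentBundle 𝓘(ℝ, E) M, v.snd ≠ 0 → 0 < L v
  homogeneous : ∀ (x : M) (y : TangentSpace 𝓘(ℝ, E) x) (c : ℝ), 0 < c →
    L ⟨x, c • y⟩ = c * L ⟨x, y⟩
  metric_pos : ∀ v : TangentBundle 𝓘(ℝ, E) M, v.snd ≠ 0 →
    ∀ X : TangentSpace 𝓘(ℝ, E) v.proj, X ≠ 0 → 0 < metric L v X X

section Curvature

variable (L : TangentBundle 𝓘(ℝ, E) M → ℝ) (v : TangentBundle 𝓘(ℝ, E) M)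

/-- The horizontal curvature tensor `R(X, Y) Z` of the Cartan connection. -/
def hCurv (X Y Z : TangentSpace 𝓘(ℝ, E) v.proj) : TangentSpace 𝓘(ℝ, E) v.proj :=
  FinslerLocal.hCurv (energy L v) (coords v) X Y Z

/-- The covariant horizontal curvature tensor `𝐑`. -/
def hCurv4 (X Y Z W : TangentSpace 𝓘(ℝ, E) v.proj) : ℝ :=
  FinslerLocal.hCurv4 (energy L v) (coords v) X Y Z W

/-- The tensor `𝐆`. -/
def tensorG (X Y Z W : TangentSpace 𝓘(ℝ, E) v.proj) : ℝ :=
  FinslerLocal.tensorG (energy L v) (coords v) X Y Z W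

/-- The `h`-covariant derivative `(∇_{βU} 𝐑)(X, Y, Z, W)`. -/
def hCovHCurv4 (U X Y Z W : TangentSpace 𝓘(ℝ, E) v.proj) : ℝ :=
  FinslerLocal.hCov (energy L v) (FinslerLocal.hCurv4 (energy L v)) (coords v) U X Y Z W

variable [FiniteDimensional ℝ E]

/-- The horizontal scalar curvature `r`. -/
def scalarCurv : ℝ :=
  FinslerLocal.scalarCurv (energy L v) (coords v)

/-- The Kulkarni-Nomizu product `g ∧ Ric`. -/
def kulkarniNomizu (X Y Z W : TangentSpace 𝓘(ℝ, E) v.proj) : ℝ :=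
  FinslerLocal.kulkarniNomizu (energy L v) (coords v) X Y Z W

/-- The conharmonic curvature tensor `ℂ`. -/
def conharmonic (X Y Z W : TangentSpace 𝓘(ℝ, E) v.proj) : ℝ :=
  FinslerLocal.conharmonic (energy L v) (coords v) X Y Z W

/-- The `h`-covariant derivative `(∇_{βU} ℂ)(X, Y, Z, W)`. -/
def hCovConharmonic (U X Y Z W : TangentSpace 𝓘(ℝ, E) v.proj) : ℝ :=
  FinslerLocal.hCov (energy L v) (FinslerLocal.conharmonic (energy L v)) (coords v) U X Y Z W

end Curvature

/-- A scalar `π`-form of degree one: a covector on `T_x M` for each `v ∈ T_x M`.  Only its values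
at the nonzero `v` are of interest. -/
abbrev PiForm (E : Type*) [NormedAddCommGroup E] [NormedSpace ℝ E]
    (M : Type*) [TopologicalSpace M] [ChartedSpace E M] [IsManifold 𝓘(ℝ, E) ∞ M] :=
  ∀ v : TangentBundle 𝓘(ℝ, E) M, TangentSpace 𝓘(ℝ, E) v.proj →L[ℝ] ℝ

/-- Smoothness on the bundle of nonzero vectors: near each nonzero `v₀`, the values of the form on
the coordinate vector fields of the chart of `M` at the base point of `v₀` are smooth. -/
def PiForm.IsSmooth (A : PiForm E M) : Prop :=
  ∀ v₀ : TangentBundle 𝓘(ℝ, E) M, v₀.snd ≠ 0 → ∀ u : E,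
    ContMDiffAt 𝓘(ℝ, E).tangent 𝓘(ℝ, ℝ) ∞
      (fun v : TangentBundle 𝓘(ℝ, E) M =>
        A v (tangentCoordChange 𝓘(ℝ, E) v₀.proj v.proj v.proj u)) v₀

/-- The form is not the zero form on the bundle of nonzero vectors. -/
def PiForm.IsNonzero (A : PiForm E M) : Prop :=
  ∃ v : TangentBundle 𝓘(ℝ, E) M, v.snd ≠ 0 ∧ A v ≠ 0

/-- Positive homogeneity of degree zero in the directional argument. -/
def PiForm.IsHomogeneous (A : PiForm E M) : Prop :=
  ∀ (x : M) (y : TangentSpace 𝓘(ℝ, E) x) (c : ℝ), y ≠ 0 → 0 < c →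
    A ⟨x, c • y⟩ = A ⟨x, y⟩

/-- The horizontal curvature tensor is not the zero tensor. -/
def HasNonzeroHCurv (L : TangentBundle 𝓘(ℝ, E) M → ℝ) : Prop :=
  ∃ v : TangentBundle 𝓘(ℝ, E) M, v.snd ≠ 0 ∧
    ∃ X Y Z : TangentSpace 𝓘(ℝ, E) v.proj, hCurv L v X Y Z ≠ 0

variable [FiniteDimensional ℝ E]

/-- `(M, L)` is hyper-generalized recurrent with recurrence forms `A` and `B`:
`∇ʰ 𝐑 = A ⊗ 𝐑 + B ⊗ (g ∧ Ric)`. -/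
structure IsHyperGeneralizedRecurrent (L : TangentBundle 𝓘(ℝ, E) M → ℝ)
    (A B : PiForm E M) : Prop where
  finsler : IsFinsler L
  dim : 3 ≤ Module.finrank ℝ E
  curv : HasNonzeroHCurv L
  smooth_A : A.IsSmooth
  smooth_B : B.IsSmooth
  nonzero_A : A.IsNonzero
  nonzero_B : B.IsNonzero
  recurrence : ∀ v : TangentBundle 𝓘(ℝ, E) M, v.snd ≠ 0 →
    ∀ U X Y Z W : TangentSpace 𝓘(ℝ, E) v.proj,
      hCovHCurv4 L v U X Y Z W
        = A v U * hCurv4 L v X Y Z W + B v U * kulkarniNomizu L v X Y Z W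

/-- The equation `∇ʰ ℂ = A ⊗ ℂ`. -/
def ConharmonicRecurrence (L : TangentBundle 𝓘(ℝ, E) M → ℝ) (A : PiForm E M) : Prop :=
  ∀ v : TangentBundle 𝓘(ℝ, E) M, v.snd ≠ 0 → ∀ U X Y Z W : TangentSpace 𝓘(ℝ, E) v.proj,
    hCovConharmonic L v U X Y Z W = A v U * conharmonic L v X Y Z W

/-- The equation `∇ʰ ℂ = A ⊗ ℂ + B ⊗ 𝐆`. -/
def GeneralizedConharmonicRecurrence (L : TangentBundle 𝓘(ℝ, E) M → ℝ)
    (A B : PiForm E M) : Prop :=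
  ∀ v : TangentBundle 𝓘(ℝ, E) M, v.snd ≠ 0 → ∀ U X Y Z W : TangentSpace 𝓘(ℝ, E) v.proj,
    hCovConharmonic L v U X Y Z W
      = A v U * conharmonic L v X Y Z W + B v U * tensorG L v X Y Z W

/-- `(M, L)` is conharmonically recurrent. -/
def IsConharmonicallyRecurrent (L : TangentBundle 𝓘(ℝ, E) M → ℝ) : Prop :=
  IsFinsler L ∧ 3 ≤ Module.finrank ℝ E ∧ HasNonzeroHCurv L ∧
    ∃ A : PiForm E M, A.IsSmooth ∧ A.IsNonzero ∧ A.IsHomogeneous ∧ ConharmonicRecurrence L A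

/-- `(M, L)` is generalized conharmonically recurrent. -/
def IsGeneralizedConharmonicallyRecurrent (L : TangentBundle 𝓘(ℝ, E) M → ℝ) : Prop :=
  IsFinsler L ∧ 3 ≤ Module.finrank ℝ E ∧ HasNonzeroHCurv L ∧
    ∃ A B : PiForm E M, A.IsSmooth ∧ A.IsNonzero ∧ A.IsHomogeneous ∧
      B.IsSmooth ∧ B.IsNonzero ∧ B.IsHomogeneous ∧ GeneralizedConharmonicRecurrence L A B

end Finsler

end

section

set_option maxSynthPendingDepth 3

/-! ### Tensor calculus in one chart: recurrence, contraction, homogeneity. -/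

namespace FinslerLocal

variable {E : Type*} [NormedAddCommGroup E] [NormedSpace ℝ E]
variable {V : Type*} [NormedAddCommGroup V] [NormedSpace ℝ V]
variable {F : E × E → ℝ} {z : E × E}

/-! The Cartan connection is metric, so covariant differentiation commutes with raising indices and
with traces. Contracting the recurrence equation in its second and fourth arguments turns `g ∧ Ric`
into `(n - 2) Ric + r g`, hence `∇ʰ Ric = A ⊗ Ric + B ⊗ ((n - 2) Ric + r g)`
(`dHor_ricci_of_recurrence`). In `∇ʰ ℂ = ∇ʰ 𝐑 - (1 / (n - 2)) g ∧ ∇ʰ Ric` the terms `B ⊗ (g ∧ Ric)`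
cancel, and since `g ∧ g = 2 𝐆` what is left is `∇ʰ ℂ = A ⊗ ℂ - (2 r / (n - 2)) B ⊗ 𝐆`
(`hCov_conharmonic_of_recurrence`). The second form has the zeros of `B` where `r ≠ 0` and vanishes
where `r = 0`; this gives both cases with the given `A`.

Two points remain. The new form is smooth only if `r` is, and `r` at `v` is computed in the chart
preferred at `v`, which varies with `v`; so the scalar curvature must be shown independent of
coordinates (`IsCoordChange.scalarCurv_eq`). The forms must also be made homogeneous: `ℂ`, `∇ʰ ℂ`
and `𝐆` have degree 0 in `y`, so the equation at `v` stays valid when `A` and `B` are evaluated at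
the multiple of `v` lying on a fixed level of `L`, and such forms are constant along rays
(`PiForm.rescale`). A suitable choice of levels, or the mean of two of them, keeps the forms nonzero
(`exists_homogeneous_forms`). -/

lemma dPos_apply (f : E × E → V) (z : E × E) (u : E) : dPos f z u = fderiv ℝ f z (u, 0) := rfl

lemma dDir_apply (f : E × E → V) (z : E × E) (u : E) : dDir f z u = fderiv ℝ f z (0, u) := rfl

lemma dHor_apply (F : E × E → ℝ) (f : E × E → V) (z : E × E) (u : E) :
    dHor F f z u = fderiv ℝ f z (u, -nonlin F z u) := by
  have h : (u, -nonlin F z u) = (u, (0 : E)) - (0, nonlin F z u) := by simp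
  rw [h, map_sub]
  rfl

/-! ### Smoothness -/

lemma contDiffAt_dPos {f : E × E → V} (hf : ContDiffAt ℝ ∞ f z) : ContDiffAt ℝ ∞ (dPos f) z :=
  (hf.fderiv_right (m := ∞) le_rfl).clm_comp contDiffAt_const

lemma contDiffAt_dDir {f : E × E → V} (hf : ContDiffAt ℝ ∞ f z) : ContDiffAt ℝ ∞ (dDir f) z :=
  (hf.fderiv_right (m := ∞) le_rfl).clm_comp contDiffAt_const

lemma contDiffAt_metric (hF : ContDiffAt ℝ ∞ F z) : ContDiffAt ℝ ∞ (metric F) z :=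
  contDiffAt_dDir (contDiffAt_dDir hF)

lemma contDiffAt_sharp [CompleteSpace E] (hF : ContDiffAt ℝ ∞ F z)
    (hg : (metric F z).IsInvertible) : ContDiffAt ℝ ∞ (sharp F) z :=
  ContDiffAt.comp z hg.contDiffAt_map_inverse (contDiffAt_metric hF)

lemma contDiffAt_spray [CompleteSpace E] (hF : ContDiffAt ℝ ∞ F z)
    (hg : (metric F z).IsInvertible) : ContDiffAt ℝ ∞ (spray F) z := by
  unfold spray
  exact contDiffAt_const.smul ((contDiffAt_sharp hF hg).clm_apply
    (((contDiffAt_dPos (contDiffAt_dDir hF)).clm_apply contDiffAt_snd).sub (contDiffAt_dPos hF)))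

lemma contDiffAt_nonlin [CompleteSpace E] (hF : ContDiffAt ℝ ∞ F z)
    (hg : (metric F z).IsInvertible) : ContDiffAt ℝ ∞ (nonlin F) z :=
  contDiffAt_dDir (contDiffAt_spray hF hg)

lemma contDiffAt_dHor [CompleteSpace E] (hF : ContDiffAt ℝ ∞ F z)
    (hg : (metric F z).IsInvertible) {f : E × E → V} (hf : ContDiffAt ℝ ∞ f z) :
    ContDiffAt ℝ ∞ (dHor F f) z :=
  (contDiffAt_dPos hf).sub ((contDiffAt_dDir hf).clm_comp (contDiffAt_nonlin hF hg))

lemma contDiffAt_flip {G G' : Type*} [NormedAddCommGroup G] [NormedSpace ℝ G]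
    [NormedAddCommGroup G'] [NormedSpace ℝ G'] {f : E × E → G →L[ℝ] G' →L[ℝ] V}
    (hf : ContDiffAt ℝ ∞ f z) : ContDiffAt ℝ ∞ (fun p => (f p).flip) z :=
  (ContinuousLinearMap.flipₗᵢ ℝ G G' V).contDiff.contDiffAt.comp z hf

lemma contDiffAt_compL {G : Type*} [NormedAddCommGroup G] [NormedSpace ℝ G] {f : E × E → V →L[ℝ] G}
    (hf : ContDiffAt ℝ ∞ f z) :
    ContDiffAt ℝ ∞ (fun p => ContinuousLinearMap.compL ℝ E V G (f p)) z :=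
  (ContinuousLinearMap.compL ℝ E V G).contDiff.contDiffAt.comp z hf

lemma contDiffAt_horCoeff [CompleteSpace E] (hF : ContDiffAt ℝ ∞ F z)
    (hg : (metric F z).IsInvertible) : ContDiffAt ℝ ∞ (horCoeff F) z := by
  have h := contDiffAt_dHor hF hg (contDiffAt_metric hF)
  exact ContDiffAt.const_smul (1 / 2 : ℝ) ((contDiffAt_compL (contDiffAt_sharp hF hg)).clm_comp
    ((h.add (contDiffAt_flip h)).sub (contDiffAt_const.clm_comp (contDiffAt_flip h))))

lemma contDiffAt_vertCoeff [CompleteSpace E] (hF : ContDiffAt ℝ ∞ F z)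
    (hg : (metric F z).IsInvertible) : ContDiffAt ℝ ∞ (vertCoeff F) z :=
  ContDiffAt.const_smul (1 / 2 : ℝ) ((contDiffAt_compL (contDiffAt_sharp hF hg)).clm_comp
    (contDiffAt_dDir (contDiffAt_metric hF)))

lemma contDiffAt_nonlinCurv [CompleteSpace E] (hF : ContDiffAt ℝ ∞ F z)
    (hg : (metric F z).IsInvertible) : ContDiffAt ℝ ∞ (nonlinCurv F) z := by
  have h := contDiffAt_dHor hF hg (contDiffAt_nonlin hF hg)
  exact h.sub (contDiffAt_flip h)

lemma contDiffAt_hCurv [CompleteSpace E] (hF : ContDiffAt ℝ ∞ F z)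
    (hg : (metric F z).IsInvertible) : ContDiffAt ℝ ∞ (hCurv F) z := by
  have h := contDiffAt_horCoeff hF hg
  have h1 := contDiffAt_dHor hF hg h
  have h2 : ContDiffAt ℝ ∞ (fun p =>
      (ContinuousLinearMap.compL ℝ E E E).bilinearComp (horCoeff F p) (horCoeff F p)) z :=
    -- `bilinearComp` unfolds to two compositions and two flips.
    contDiffAt_flip
      ((contDiffAt_flip (contDiffAt_const.clm_comp h)).clm_comp h)
  exact ((((h1.sub (contDiffAt_flip h1)).add h2).sub (contDiffAt_flip h2)).add
    ((contDiffAt_compL (contDiffAt_vertCoeff hF hg)).clm_comp (contDiffAt_nonlinCurv hF hg))).neg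

lemma contDiffAt_ricci [FiniteDimensional ℝ E] (hF : ContDiffAt ℝ ∞ F z)
    (hg : (metric F z).IsInvertible) : ContDiffAt ℝ ∞ (ricci F) z := by
  have : CompleteSpace E := FiniteDimensional.complete ℝ E
  exact contDiffAt_const.clm_comp (contDiffAt_const.clm_comp (contDiffAt_hCurv hF hg))

lemma contDiffAt_scalarCurv [FiniteDimensional ℝ E] (hF : ContDiffAt ℝ ∞ F z)
    (hg : (metric F z).IsInvertible) : ContDiffAt ℝ ∞ (scalarCurv F) z := by
  have : CompleteSpace E := FiniteDimensional.complete ℝ E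
  exact contDiffAt_const.clm_apply ((contDiffAt_sharp hF hg).clm_comp (contDiffAt_ricci hF hg))

/-! ### Components -/

/-- The metric is the vertical block of the second derivative of `F`, which is symmetric. -/
lemma metric_symm (hF : ContDiffAt ℝ 2 F z) (u w : E) : metric F z u w = metric F z w u := by
  have h1 : DifferentiableAt ℝ (fderiv ℝ F) z :=
    (hF.fderiv_right (m := 1) (by norm_num)).differentiableAt (by simp)
  have h : ∀ u w : E, metric F z u w = fderiv ℝ (fderiv ℝ F) z (0, u) (0, w) := by
    intro u w
    have h2 : HasFDerivAt (dDir F) _ z :=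
      h1.hasFDerivAt.clm_comp (hasFDerivAt_const (ContinuousLinearMap.inr ℝ E E) z)
    rw [metric, dDir_apply, h2.fderiv]
    simp
  rw [h, h]
  exact (hF.isSymmSndFDerivAt (by simp)).eq _ _

lemma metric_sharp (hg : (metric F z).IsInvertible) (α : E →L[ℝ] ℝ) (w : E) :
    metric F z (sharp F z α) w = α w := by
  rw [sharp, hg.self_apply_inverse]

lemma fderiv_apply {f : E × E → E →L[ℝ] V} (hf : DifferentiableAt ℝ f z) (d : E × E) (u : E) :
    fderiv ℝ (fun p => f p u) z d = fderiv ℝ f z d u := by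
  rw [fderiv_clm_apply hf (differentiableAt_const u)]
  simp

lemma dHor_metric_symm (hF : ContDiffAt ℝ ∞ F z) (u w l : E) :
    dHor F (metric F) z u w l = dHor F (metric F) z u l w := by
  have hd : DifferentiableAt ℝ (metric F) z := (contDiffAt_metric hF).differentiableAt (by simp)
  have h : ∀ w l : E, dHor F (metric F) z u w l
      = fderiv ℝ (fun p => metric F p w l) z (u, -nonlin F z u) := by
    intro w l
    rw [dHor_apply, fderiv_apply (hd.clm_apply (differentiableAt_const w)), fderiv_apply hd]
  rw [h, h]
  congr 1
  apply Filter.EventuallyEq.fderiv_eq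
  -- Finite order is what spreads from a point to a neighbourhood, where symmetry is then available
  -- for differentiation.
  have h2 := hF.of_le (m := 2) (WithTop.coe_le_coe.2 (le_top : (2 : ℕ∞) ≤ ⊤))
  filter_upwards [h2.eventually (by simp)] with p hp
  exact metric_symm hp w l

lemma metric_horCoeff (hg : (metric F z).IsInvertible) (u w l : E) :
    metric F z (horCoeff F z u w) l = (1 / 2) * (dHor F (metric F) z u w l
      + dHor F (metric F) z w u l - dHor F (metric F) z l u w) := by
  have : horCoeff F z u w = (1 / 2 : ℝ) • sharp F z (dHor F (metric F) z u w
      + (dHor F (metric F) z).flip u w - rotate (dHor F (metric F) z) u w) := rfl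
  rw [this, map_smul, smul_apply, metric_sharp hg]
  rfl

/-- Metric compatibility, `∇_{βu} g = 0`: of the two Christoffel combinations the terms
antisymmetric in `w` and `l` cancel. -/
lemma dHor_metric (hF : ContDiffAt ℝ ∞ F z) (hg : (metric F z).IsInvertible) (u w l : E) :
    dHor F (metric F) z u w l
      = metric F z (horCoeff F z u w) l + metric F z w (horCoeff F z u l) := by
  rw [metric_symm (hF.of_le (WithTop.coe_le_coe.2 (le_top : (2 : ℕ∞) ≤ ⊤))) w,
    metric_horCoeff hg, metric_horCoeff hg, dHor_metric_symm hF u l w,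
    dHor_metric_symm hF w u l, dHor_metric_symm hF l u w]
  ring

lemma metric_vertCoeff (hg : (metric F z).IsInvertible) (u w l : E) :
    metric F z (vertCoeff F z u w) l = (1 / 2) * dDir (metric F) z u w l := by
  have : vertCoeff F z u w = (1 / 2 : ℝ) • sharp F z (dDir (metric F) z u w) := rfl
  rw [this, map_smul, smul_apply, metric_sharp hg]
  rfl

lemma hCurv_apply (F : E × E → ℝ) (z : E × E) (X Y Z : E) :
    hCurv F z X Y Z = -(dHor F (horCoeff F) z X Y Z - dHor F (horCoeff F) z Y X Z
      + horCoeff F z X (horCoeff F z Y Z) - horCoeff F z Y (horCoeff F z X Z)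
      + vertCoeff F z (nonlinCurv F z X Y) Z) := rfl

lemma ricci_apply [FiniteDimensional ℝ E] (F : E × E → ℝ) (z : E × E) (X Z : E) :
    ricci F z X Z = endTrace ((hCurv F z X).flip Z) := rfl

lemma metric_ricciForm [FiniteDimensional ℝ E] (hg : (metric F z).IsInvertible) (X W : E) :
    metric F z (ricciForm F z X) W = ricci F z X W :=
  metric_sharp hg _ _

/-! ### Contraction of the recurrence equation -/

lemma dHor_clm_apply {f : E × E → E →L[ℝ] V} (hf : DifferentiableAt ℝ f z) (u w : E) :
    dHor F (fun p => f p w) z u = dHor F f z u w := by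
  rw [dHor_apply, dHor_apply, fderiv_apply hf]

lemma dHor_add {f g : E × E → V} (hf : DifferentiableAt ℝ f z) (hg : DifferentiableAt ℝ g z)
    (u : E) : dHor F (fun p => f p + g p) z u = dHor F f z u + dHor F g z u := by
  simp only [dHor_apply]
  rw [fderiv_fun_add hf hg]
  rfl

lemma dHor_sub {f g : E × E → V} (hf : DifferentiableAt ℝ f z) (hg : DifferentiableAt ℝ g z)
    (u : E) : dHor F (fun p => f p - g p) z u = dHor F f z u - dHor F g z u := by
  simp only [dHor_apply]
  rw [fderiv_fun_sub hf hg]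
  rfl

lemma dHor_mul {f g : E × E → ℝ} (hf : DifferentiableAt ℝ f z) (hg : DifferentiableAt ℝ g z)
    (u : E) : dHor F (fun p => f p * g p) z u = f z * dHor F g z u + g z * dHor F f z u := by
  simp only [dHor_apply]
  rw [fderiv_fun_mul hf hg]
  rfl

lemma dHor_const_mul (c : ℝ) {f : E × E → ℝ} (hf : DifferentiableAt ℝ f z)
    (u : E) : dHor F (fun p => c * f p) z u = c * dHor F f z u := by
  simp only [dHor_apply]
  rw [fderiv_const_mul hf]
  rfl

lemma dHor_metric_apply (hF : ContDiffAt ℝ ∞ F z) {f : E × E → E} (hf : DifferentiableAt ℝ f z)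
    (u w : E) : dHor F (fun p => metric F p (f p) w) z u
      = dHor F (metric F) z u (f z) w + metric F z (dHor F f z u) w := by
  have hd : DifferentiableAt ℝ (metric F) z := (contDiffAt_metric hF).differentiableAt (by simp)
  rw [dHor_clm_apply (hd.clm_apply hf), dHor_apply, dHor_apply, dHor_apply,
    fderiv_clm_apply hd hf]
  simp [add_comm]

/-- As `∇ g = 0`, lowering the last index commutes with `∇`: the right side is `g((∇_{βU} R)(X, Y)
Z, W)`. -/
lemma hCov_hCurv4 [CompleteSpace E] (hF : ContDiffAt ℝ ∞ F z) (hg : (metric F z).IsInvertible)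
    (U X Y Z W : E) :
    hCov F (hCurv4 F) z U X Y Z W = metric F z (dHor F (hCurv F) z U X Y Z
      + horCoeff F z U (hCurv F z X Y Z) - hCurv F z (horCoeff F z U X) Y Z
      - hCurv F z X (horCoeff F z U Y) Z - hCurv F z X Y (horCoeff F z U Z)) W := by
  have hd : DifferentiableAt ℝ (hCurv F) z := (contDiffAt_hCurv hF hg).differentiableAt (by simp)
  have hX := hd.clm_apply (differentiableAt_const X)
  have hY := hX.clm_apply (differentiableAt_const Y)
  have hZ := hY.clm_apply (differentiableAt_const Z)
  unfold hCov hCurv4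
  rw [dHor_metric_apply hF hZ, dHor_metric hF hg, dHor_clm_apply hY, dHor_clm_apply hX,
    dHor_clm_apply hd]
  simp only [map_add, map_sub, add_apply, sub_apply]
  ring

section Trace

variable [FiniteDimensional ℝ E]

lemma endTrace_comp_comm (f g : E →L[ℝ] E) : endTrace (f.comp g) = endTrace (g.comp f) :=
  LinearMap.trace_mul_comm ℝ (f : E →ₗ[ℝ] E) (g : E →ₗ[ℝ] E)

lemma endTrace_smulRight (f : E →L[ℝ] ℝ) (x : E) : endTrace (f.smulRight x) = f x :=
  LinearMap.trace_smulRight (f : E →ₗ[ℝ] ℝ) x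

lemma endTrace_id : endTrace (ContinuousLinearMap.id ℝ E) = Module.finrank ℝ E :=
  LinearMap.trace_id ℝ E

/-- Intertwined endomorphisms are conjugate. With `J = Dψ` this makes traces independent of
coordinates. -/
lemma endTrace_eq_of_comp_eq {J S T : E →L[ℝ] E} (hJ : J.IsInvertible)
    (h : ∀ u, J (S u) = T (J u)) : endTrace S = endTrace T := by
  have e : S = J.inverse.comp (T.comp J) := by
    ext u
    apply hJ.injective
    simp [hJ.self_apply_inverse, h]
  rw [e, endTrace_comp_comm, ContinuousLinearMap.comp_assoc, hJ.self_comp_inverse]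
  rfl

/-- The trace and the flip are constant linear maps, so they pass through the derivative. -/
lemma dHor_ricci (hF : ContDiffAt ℝ ∞ F z) (hg : (metric F z).IsInvertible) (U X Z : E) :
    dHor F (ricci F) z U X Z = endTrace ((dHor F (hCurv F) z U X).flip Z) := by
  have : CompleteSpace E := FiniteDimensional.complete ℝ E
  have hd : DifferentiableAt ℝ (hCurv F) z := (contDiffAt_hCurv hF hg).differentiableAt (by simp)
  have h := (hasFDerivAt_const (ContinuousLinearMap.compL ℝ E (E →L[ℝ] E) ℝ endTrace) z).clm_comp
    ((hasFDerivAt_const (((ContinuousLinearMap.flipₗᵢ ℝ E E E :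
      (E →L[ℝ] E →L[ℝ] E) ≃ₗᵢ[ℝ] (E →L[ℝ] E →L[ℝ] E)) :
      (E →L[ℝ] E →L[ℝ] E) →L[ℝ] (E →L[ℝ] E →L[ℝ] E))) z).clm_comp hd.hasFDerivAt)
  have h' : fderiv ℝ (ricci F) z = _ := h.fderiv
  rw [dHor_apply, h', dHor_apply]
  simp

/-- The contraction of `∇ʰ 𝐑 = a 𝐑 + b (g ∧ Ric)` in the second and fourth arguments. -/
lemma dHor_ricci_of_recurrence (hF : ContDiffAt ℝ ∞ F z) (hg : (metric F z).IsInvertible)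
    {U : E} {a b : ℝ} (h : ∀ X Y Z W, hCov F (hCurv4 F) z U X Y Z W
      = a * hCurv4 F z X Y Z W + b * kulkarniNomizu F z X Y Z W) (X Z : E) :
    dHor F (ricci F) z U X Z = ricci F z (horCoeff F z U X) Z + ricci F z X (horCoeff F z U Z)
      + a * ricci F z X Z + b * (((Module.finrank ℝ E : ℝ) - 2) * ricci F z X Z
        + scalarCurv F z * metric F z X Z) := by
  have : CompleteSpace E := FiniteDimensional.complete ℝ E
  -- The recurrence equation with `W` raised, as an identity of endomorphisms in the argument `Y`.
  have key : (dHor F (hCurv F) z U X).flip Z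
      + (horCoeff F z U).comp ((hCurv F z X).flip Z) - (hCurv F z (horCoeff F z U X)).flip Z
      - ((hCurv F z X).flip Z).comp (horCoeff F z U) - (hCurv F z X).flip (horCoeff F z U Z)
      = a • (hCurv F z X).flip Z + b • (metric F z X Z • ricciForm F z
        + ricci F z X Z • ContinuousLinearMap.id ℝ E - ((ricci F z).flip Z).smulRight X
        - ((metric F z).flip Z).smulRight (ricciForm F z X)) := by
    ext Y
    apply hg.injective
    ext W
    have h1 := h X Y Z W
    rw [hCov_hCurv4 hF hg, kulkarniNomizu, hCurv4] at h1
    simp only [add_apply, sub_apply, ContinuousLinearMap.comp_apply, smul_apply, map_add, map_sub,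
      map_smul, ContinuousLinearMap.flip_apply, ContinuousLinearMap.smulRight_apply, smul_eq_mul,
      metric_ricciForm hg, ContinuousLinearMap.id_apply] at h1 ⊢
    linear_combination h1
  -- The two compositions with `horCoeff F z U` have equal traces and cancel. On the right the
  -- identity contributes `n Ric(X, Z)` and each rank-one term `-Ric(X, Z)`, whence the factor `n -
  -- 2`; `ricciForm` contributes `r`.
  have h2 := congrArg endTrace key
  simp only [map_add, map_sub, map_smul, smul_eq_mul, endTrace_smulRight, endTrace_id,
    endTrace_comp_comm (horCoeff F z U), ContinuousLinearMap.flip_apply, metric_ricciForm hg,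
    ← ricci_apply, ← dHor_ricci hF hg] at h2
  have h3 : endTrace (ricciForm F z) = scalarCurv F z := rfl
  rw [h3] at h2
  linear_combination h2

/-- `∇ʰ 𝐑 = a 𝐑 + b (g ∧ Ric)` implies `∇ʰ ℂ = a ℂ - (2 r / (n - 2)) b 𝐆`. -/
theorem hCov_conharmonic_of_recurrence (hn : (Module.finrank ℝ E : ℝ) - 2 ≠ 0)
    (hF : ContDiffAt ℝ ∞ F z) (hg : (metric F z).IsInvertible)
    {U : E} {a b : ℝ} (h : ∀ X Y Z W, hCov F (hCurv4 F) z U X Y Z W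
      = a * hCurv4 F z X Y Z W + b * kulkarniNomizu F z X Y Z W) (X Y Z W : E) :
    hCov F (conharmonic F) z U X Y Z W = a * conharmonic F z X Y Z W
      + -(2 / ((Module.finrank ℝ E : ℝ) - 2)) * scalarCurv F z * b * tensorG F z X Y Z W := by
  have : CompleteSpace E := FiniteDimensional.complete ℝ E
  have hm : DifferentiableAt ℝ (metric F) z := (contDiffAt_metric hF).differentiableAt (by simp)
  have hr : DifferentiableAt ℝ (ricci F) z := (contDiffAt_ricci hF hg).differentiableAt (by simp)
  have hc : DifferentiableAt ℝ (hCurv F) z := (contDiffAt_hCurv hF hg).differentiableAt (by simp)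
  have hm1 := fun u => hm.clm_apply (differentiableAt_const u)
  have hr1 := fun u => hr.clm_apply (differentiableAt_const u)
  have hm2 := fun u w => (hm1 u).clm_apply (differentiableAt_const w)
  have hr2 := fun u w => (hr1 u).clm_apply (differentiableAt_const w)
  have hR : DifferentiableAt ℝ (fun p => hCurv4 F p X Y Z W) z :=
    (hm.clm_apply (((hc.clm_apply (differentiableAt_const X)).clm_apply
      (differentiableAt_const Y)).clm_apply (differentiableAt_const Z))).clm_apply
      (differentiableAt_const W)
  have p1 := (hm2 X Z).fun_mul (hr2 Y W)
  have p2 := (hm2 Y W).fun_mul (hr2 X Z)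
  have p3 := (hm2 X W).fun_mul (hr2 Y Z)
  have p4 := (hm2 Y Z).fun_mul (hr2 X W)
  have e : dHor F (fun p => kulkarniNomizu F p X Y Z W) z U
      = metric F z X Z * dHor F (ricci F) z U Y W + ricci F z Y W * dHor F (metric F) z U X Z
      + (metric F z Y W * dHor F (ricci F) z U X Z + ricci F z X Z * dHor F (metric F) z U Y W)
      - (metric F z X W * dHor F (ricci F) z U Y Z + ricci F z Y Z * dHor F (metric F) z U X W)
      - (metric F z Y Z * dHor F (ricci F) z U X W
        + ricci F z X W * dHor F (metric F) z U Y Z) := by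
    unfold kulkarniNomizu
    rw [dHor_sub ((p1.fun_add p2).fun_sub p3) p4, dHor_sub (p1.fun_add p2) p3, dHor_add p1 p2,
      dHor_mul (hm2 X Z) (hr2 Y W), dHor_mul (hm2 Y W) (hr2 X Z), dHor_mul (hm2 X W) (hr2 Y Z),
      dHor_mul (hm2 Y Z) (hr2 X W)]
    simp only [dHor_clm_apply (hm1 _), dHor_clm_apply (hr1 _), dHor_clm_apply hm,
      dHor_clm_apply hr]
  have hK : DifferentiableAt ℝ (fun p => kulkarniNomizu F p X Y Z W) z :=
    ((p1.add p2).sub p3).sub p4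
  have h1 := h X Y Z W
  unfold hCov at h1 ⊢
  unfold conharmonic
  rw [dHor_sub hR (hK.const_mul _), dHor_const_mul _ hK, e]
  -- The connection terms produced here match those in `hCov`; only the recurrence terms survive.
  simp only [dHor_metric hF hg, dHor_ricci_of_recurrence hF hg h]
  have hG : tensorG F z X Y Z W = metric F z X Z * metric F z Y W
      - metric F z Y Z * metric F z X W := by
    simp [tensorG]
  rw [hG]
  simp only [kulkarniNomizu] at h1 ⊢
  generalize (Module.finrank ℝ E : ℝ) - 2 = m at hn ⊢
  -- This cancels `1 / (n - 2)` against the `(n - 2) Ric` of the contraction, which removes `b (g ∧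
  -- Ric)`.
  have hm' : m⁻¹ * m = 1 := inv_mul_cancel₀ hn
  simp only [div_eq_mul_inv]
  linear_combination h1 - b * (metric F z X Z * ricci F z Y W + metric F z Y W * ricci F z X Z
    - metric F z X W * ricci F z Y Z - metric F z Y Z * ricci F z X W) * hm'

end Trace

/-! ### Homogeneity in the directional argument -/

/-- The scaling `(x, y) ↦ (x, c y)`. -/
noncomputable def scaling (E : Type*) [NormedAddCommGroup E] [NormedSpace ℝ E] (c : ℝ)
    (hc : c ≠ 0) : (E × E) ≃L[ℝ] E × E :=
  (ContinuousLinearEquiv.refl ℝ E).prodCongr (ContinuousLinearEquiv.smulLeft (Units.mk0 c hc))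

/-- `f` is multiplied by `c ^ k` under the scaling `(x, y) ↦ (x, c y)` over the set `s`. -/
def IsHomogeneousOn (s : Set E) (c : ℝ) (k : ℤ) (f : E × E → V) : Prop :=
  ∀ z : E × E, z.1 ∈ s → f (z.1, c • z.2) = c ^ k • f z

variable {s : Set E} {c : ℝ} {k l : ℤ}

/-- The chain rule for the linear scaling. Since `s` is open, the homogeneity relation is an
equality of germs and may be differentiated. -/
lemma IsHomogeneousOn.fderiv_apply {f : E × E → V} (h : IsHomogeneousOn s c k f) (hs : IsOpen s)
    (hc : c ≠ 0) (hz : z.1 ∈ s) (d : E × E) :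
    fderiv ℝ f (z.1, c • z.2) (d.1, c • d.2) = c ^ k • fderiv ℝ f z d := by
  have h1 : (f ∘ scaling E c hc) =ᶠ[nhds z] (c ^ k : ℝ) • f := by
    filter_upwards [(hs.preimage continuous_fst).mem_nhds hz] with p hp
    exact h p hp
  have h2 := h1.fderiv_eq (𝕜 := ℝ)
  rw [(scaling E c hc).comp_right_fderiv, fderiv_const_smul_field] at h2
  exact congrArg (fun T : E × E →L[ℝ] V => T d) h2

lemma IsHomogeneousOn.dPos {f : E × E → V} (h : IsHomogeneousOn s c k f) (hs : IsOpen s)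
    (hc : c ≠ 0) : IsHomogeneousOn s c k (dPos f) := by
  intro z hz
  ext u
  simpa [dPos_apply] using h.fderiv_apply hs hc hz (u, 0)

lemma IsHomogeneousOn.dDir {f : E × E → V} (h : IsHomogeneousOn s c k f) (hs : IsOpen s)
    (hc : c ≠ 0) (hl : k = l + 1) : IsHomogeneousOn s c l (dDir f) := by
  intro z hz
  ext u
  have := h.fderiv_apply hs hc hz (0, u)
  have e : ((0 : E), c • u) = c • (0, u) := by simp
  rw [e, map_smul, hl, zpow_add_one₀ hc, mul_comm, mul_smul] at this
  exact smul_right_injective V hc this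

lemma isHomogeneousOn_metric (h : IsHomogeneousOn s c 2 F) (hs : IsOpen s) (hc : c ≠ 0) :
    IsHomogeneousOn s c 0 (metric F) :=
  (h.dDir hs hc (l := 1) rfl).dDir hs hc rfl

lemma isHomogeneousOn_sharp (h : IsHomogeneousOn s c 2 F) (hs : IsOpen s) (hc : c ≠ 0) :
    IsHomogeneousOn s c 0 (sharp F) := by
  intro z hz
  have := isHomogeneousOn_metric h hs hc z hz
  simp only [zpow_zero, one_smul] at this ⊢
  rw [sharp, this, sharp]

lemma isHomogeneousOn_spray (h : IsHomogeneousOn s c 2 F) (hs : IsOpen s) (hc : c ≠ 0) :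
    IsHomogeneousOn s c 2 (spray F) := by
  intro z hz
  have h1 := isHomogeneousOn_sharp h hs hc z hz
  have h2 := (h.dDir hs hc (l := 1) rfl).dPos hs hc z hz
  have h3 := h.dPos hs hc z hz
  simp only [zpow_zero, one_smul, zpow_one] at h1 h2
  have e : c ^ (2 : ℤ) = c * c := by rw [zpow_ofNat, sq]
  simp only [spray]
  rw [h1, h2, h3, e, smul_apply, map_smul, smul_smul, ← smul_sub, map_smul, smul_comm]

lemma isHomogeneousOn_nonlin (h : IsHomogeneousOn s c 2 F) (hs : IsOpen s) (hc : c ≠ 0) :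
    IsHomogeneousOn s c 1 (nonlin F) :=
  (isHomogeneousOn_spray h hs hc).dDir hs hc rfl

/-- As `nonlin F` has degree 1, scaling carries the horizontal direction `(u, -N u)` to the
horizontal direction of the same `u`; the degree is therefore kept. -/
lemma IsHomogeneousOn.dHor (h : IsHomogeneousOn s c 2 F) (hs : IsOpen s) (hc : c ≠ 0)
    {f : E × E → V} (hf : IsHomogeneousOn s c k f) : IsHomogeneousOn s c k (dHor F f) := by
  intro z hz
  ext u
  have h1 := isHomogeneousOn_nonlin h hs hc z hz
  rw [zpow_one] at h1
  have h2 := hf.fderiv_apply hs hc hz (u, -nonlin F z u)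
  rw [smul_apply, dHor_apply, dHor_apply, h1, ← h2, smul_apply, smul_neg]

lemma isHomogeneousOn_horCoeff (h : IsHomogeneousOn s c 2 F) (hs : IsOpen s) (hc : c ≠ 0) :
    IsHomogeneousOn s c 0 (horCoeff F) := by
  intro z hz
  have h1 := isHomogeneousOn_sharp h hs hc z hz
  have h2 := IsHomogeneousOn.dHor h hs hc (isHomogeneousOn_metric h hs hc) z hz
  simp only [zpow_zero, one_smul] at h1 h2 ⊢
  rw [horCoeff, h1, h2, horCoeff]

lemma isHomogeneousOn_vertCoeff (h : IsHomogeneousOn s c 2 F) (hs : IsOpen s) (hc : c ≠ 0) :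
    IsHomogeneousOn s c (-1) (vertCoeff F) := by
  intro z hz
  have h1 := isHomogeneousOn_sharp h hs hc z hz
  have h2 := (isHomogeneousOn_metric h hs hc).dDir hs hc (l := -1) rfl z hz
  simp only [zpow_zero, one_smul] at h1
  rw [vertCoeff, h1, h2, ContinuousLinearMap.comp_smul, smul_comm, vertCoeff]

lemma isHomogeneousOn_nonlinCurv (h : IsHomogeneousOn s c 2 F) (hs : IsOpen s) (hc : c ≠ 0) :
    IsHomogeneousOn s c 1 (nonlinCurv F) := by
  intro z hz
  have h1 := IsHomogeneousOn.dHor h hs hc (isHomogeneousOn_nonlin h hs hc) z hz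
  ext u w
  rw [nonlinCurv, h1, nonlinCurv]
  simp [smul_sub]

/-- In the last term of the curvature the degree `-1` of `vertCoeff` compensates the degree `1` of
`nonlinCurv`. -/
lemma isHomogeneousOn_hCurv (h : IsHomogeneousOn s c 2 F) (hs : IsOpen s) (hc : c ≠ 0) :
    IsHomogeneousOn s c 0 (hCurv F) := by
  intro z hz
  have h1 := isHomogeneousOn_horCoeff h hs hc z hz
  have h2 := IsHomogeneousOn.dHor h hs hc (isHomogeneousOn_horCoeff h hs hc) z hz
  have h3 := isHomogeneousOn_vertCoeff h hs hc z hz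
  have h4 := isHomogeneousOn_nonlinCurv h hs hc z hz
  simp only [zpow_zero, one_smul] at h1 h2 ⊢
  ext X Y Z
  rw [hCurv_apply, hCurv_apply, h1, h2, h3, h4]
  simp [smul_smul, hc]

lemma hCurv4_smul (h : IsHomogeneousOn s c 2 F) (hs : IsOpen s) (hc : c ≠ 0) (hz : z.1 ∈ s)
    (X Y Z W : E) : hCurv4 F (z.1, c • z.2) X Y Z W = hCurv4 F z X Y Z W := by
  have h1 := isHomogeneousOn_metric h hs hc z hz
  have h2 := isHomogeneousOn_hCurv h hs hc z hz
  simp only [zpow_zero, one_smul] at h1 h2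
  rw [hCurv4, h1, h2, hCurv4]

lemma tensorG_smul (h : IsHomogeneousOn s c 2 F) (hs : IsOpen s) (hc : c ≠ 0) (hz : z.1 ∈ s)
    (X Y Z W : E) : tensorG F (z.1, c • z.2) X Y Z W = tensorG F z X Y Z W := by
  have h1 := isHomogeneousOn_metric h hs hc z hz
  simp only [zpow_zero, one_smul] at h1
  rw [tensorG, h1, tensorG]

lemma hCov_smul (h : IsHomogeneousOn s c 2 F) (hs : IsOpen s) (hc : c ≠ 0) (hz : z.1 ∈ s)
    {T : E × E → E → E → E → E → ℝ}
    (hT : ∀ z : E × E, z.1 ∈ s → ∀ X Y Z W, T (z.1, c • z.2) X Y Z W = T z X Y Z W)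
    (U X Y Z W : E) : hCov F T (z.1, c • z.2) U X Y Z W = hCov F T z U X Y Z W := by
  have h1 := isHomogeneousOn_horCoeff h hs hc z hz
  have h2 : IsHomogeneousOn s c 0 (fun p => T p X Y Z W) := by
    intro z hz
    simpa using hT z hz X Y Z W
  have h3 := IsHomogeneousOn.dHor h hs hc h2 z hz
  simp only [zpow_zero, one_smul] at h1 h3
  rw [hCov, h1, h3, hT z hz, hT z hz, hT z hz, hT z hz, hCov]

section Ricci

variable [FiniteDimensional ℝ E]

lemma ricci_smul (h : IsHomogeneousOn s c 2 F) (hs : IsOpen s) (hc : c ≠ 0) (hz : z.1 ∈ s) :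
    ricci F (z.1, c • z.2) = ricci F z := by
  have h2 := isHomogeneousOn_hCurv h hs hc z hz
  simp only [zpow_zero, one_smul] at h2
  rw [ricci, h2, ricci]

lemma scalarCurv_smul (h : IsHomogeneousOn s c 2 F) (hs : IsOpen s) (hc : c ≠ 0)
    (hz : z.1 ∈ s) : scalarCurv F (z.1, c • z.2) = scalarCurv F z := by
  have h1 := isHomogeneousOn_sharp h hs hc z hz
  simp only [zpow_zero, one_smul] at h1
  rw [scalarCurv, ricciForm, h1, ricci_smul h hs hc hz, scalarCurv, ricciForm]

lemma conharmonic_smul (h : IsHomogeneousOn s c 2 F) (hs : IsOpen s) (hc : c ≠ 0)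
    (hz : z.1 ∈ s) (X Y Z W : E) :
    conharmonic F (z.1, c • z.2) X Y Z W = conharmonic F z X Y Z W := by
  have h1 := isHomogeneousOn_metric h hs hc z hz
  simp only [zpow_zero, one_smul] at h1
  rw [conharmonic, hCurv4_smul h hs hc hz, kulkarniNomizu, h1, ricci_smul h hs hc hz, conharmonic,
    kulkarniNomizu]

end Ricci

end FinslerLocal

/-! ### Transformation laws under a change of chart. -/

namespace FinslerLocal

variable {E : Type*} [NormedAddCommGroup E] [NormedSpace ℝ E]
variable {V : Type*} [NormedAddCommGroup V] [NormedSpace ℝ V]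

/-! ### Change of coordinates -/

/-- The map `(x, y) ↦ (ψ x, Dψ(x) y)` of tangent vectors induced by a change of coordinates `ψ`. -/
noncomputable def tangentLift (ψ : E → E) (z : E × E) : E × E := (ψ z.1, fderiv ℝ ψ z.1 z.2)

/-- The function `F'` is `F` read, over the open set `U`, in the coordinates related to those
of `F` by `ψ`. -/
structure IsCoordChange (F F' : E × E → ℝ) (ψ : E → E) (U : Set (E × E)) : Prop where
  isOpen : IsOpen U
  contDiffAt : ∀ z ∈ U, ContDiffAt ℝ ∞ ψ z.1
  isInvertible : ∀ z ∈ U, (fderiv ℝ ψ z.1).IsInvertible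
  contDiffAt_energy : ∀ z ∈ U, ContDiffAt ℝ ∞ F (tangentLift ψ z)
  isInvertible_metric : ∀ z ∈ U, (metric F (tangentLift ψ z)).IsInvertible
  eq : ∀ z ∈ U, F' z = F (tangentLift ψ z)

lemma dHor_congr {F : E × E → ℝ} {f g : E × E → V} {z : E × E} (h : f =ᶠ[nhds z] g) :
    dHor F f z = dHor F g z := by
  ext u
  rw [dHor_apply, dHor_apply, h.fderiv_eq]

lemma dHor_apply_of_differentiableAt {G : Type*} [NormedAddCommGroup G] [NormedSpace ℝ G]
    {F : E × E → ℝ} {c : E × E → G →L[ℝ] V} {v : E × E → G}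
    {z : E × E} (hc : DifferentiableAt ℝ c z) (hv : DifferentiableAt ℝ v z) (u : E) :
    dHor F (fun p => c p (v p)) z u = dHor F c z u (v z) + c z (dHor F v z u) := by
  simp only [dHor_apply]
  rw [fderiv_clm_apply hc hv]
  simp [add_comm]

/-- A finite-dimensional space and its dual have equal dimension. -/
lemma isInvertible_of_injective [FiniteDimensional ℝ E] {T : E →L[ℝ] E →L[ℝ] ℝ}
    (hT : Function.Injective T) : T.IsInvertible := by
  have h : Module.finrank ℝ E = Module.finrank ℝ (E →L[ℝ] ℝ) := by
    rw [← (LinearMap.toContinuousLinearMap (𝕜 := ℝ) (E := E) (F' := ℝ)).finrank_eq]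
    exact (Subspace.dual_finrank_eq (K := ℝ) (V := E)).symm
  refine ⟨(LinearEquiv.ofInjectiveOfFinrankEq (T : E →ₗ[ℝ] E →L[ℝ] ℝ) hT h).toContinuousLinearEquiv,
    ?_⟩
  ext u w
  rfl

namespace IsCoordChange

variable {F F' : E × E → ℝ} {ψ : E → E} {U : Set (E × E)} {z : E × E}

lemma differentiableAt_fderiv (h : ContDiffAt ℝ ∞ ψ z.1) :
    DifferentiableAt ℝ (fun p : E × E => fderiv ℝ ψ p.1) z := by
  have := (h.fderiv_right (m := ∞) le_rfl).differentiableAt (by simp)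
  exact this.comp z differentiableAt_fst

lemma differentiableAt_fderiv_fderiv (h : ContDiffAt ℝ ∞ ψ z.1) :
    DifferentiableAt ℝ (fun p : E × E => fderiv ℝ (fderiv ℝ ψ) p.1) z := by
  have := ((h.fderiv_right (m := ∞) le_rfl).fderiv_right (m := ∞) le_rfl).differentiableAt (by simp)
  exact this.comp z differentiableAt_fst

lemma fderiv_comp_fst {f : E → V} (h : DifferentiableAt ℝ f z.1) (d : E × E) :
    fderiv ℝ (fun p : E × E => f p.1) z d = fderiv ℝ f z.1 d.1 := by
  have := (h.hasFDerivAt.comp z hasFDerivAt_fst).fderiv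
  exact congrArg (fun T : E × E →L[ℝ] V => T d) this

lemma fderiv_fderiv (h : ContDiffAt ℝ ∞ ψ z.1) (d : E × E) :
    fderiv ℝ (fun p : E × E => fderiv ℝ ψ p.1) z d = fderiv ℝ (fderiv ℝ ψ) z.1 d.1 :=
  fderiv_comp_fst ((h.fderiv_right (m := ∞) le_rfl).differentiableAt (by simp)) d

lemma contDiffAt_tangentLift (h : ContDiffAt ℝ ∞ ψ z.1) : ContDiffAt ℝ ∞ (tangentLift ψ) z := by
  have h1 : ContDiffAt ℝ ∞ (fun p : E × E => fderiv ℝ ψ p.1) z :=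
    ContDiffAt.comp z (h.fderiv_right (m := ∞) le_rfl) contDiffAt_fst
  exact (ContDiffAt.comp z h contDiffAt_fst).prodMk (h1.clm_apply contDiffAt_snd)

lemma differentiableAt_tangentLift (h : ContDiffAt ℝ ∞ ψ z.1) :
    DifferentiableAt ℝ (tangentLift ψ) z :=
  (contDiffAt_tangentLift h).differentiableAt (by simp)

lemma fderiv_tangentLift (h : ContDiffAt ℝ ∞ ψ z.1) (d : E × E) :
    fderiv ℝ (tangentLift ψ) z d
      = (fderiv ℝ ψ z.1 d.1, fderiv ℝ (fderiv ℝ ψ) z.1 d.1 z.2 + fderiv ℝ ψ z.1 d.2) := by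
  have h1 : DifferentiableAt ℝ ψ z.1 := h.differentiableAt (by simp)
  have h2 := differentiableAt_fderiv h
  have h3 : fderiv ℝ (tangentLift ψ) z = _ :=
    ((h1.comp z differentiableAt_fst).fderiv_prodMk (h2.clm_apply differentiableAt_snd))
  rw [h3, ContinuousLinearMap.prod_apply]
  refine Prod.ext (fderiv_comp_fst h1 d) ?_
  change fderiv ℝ (fun p : E × E => fderiv ℝ ψ p.1 p.2) z d = _
  rw [fderiv_clm_apply h2 differentiableAt_snd]
  simp [fderiv_fderiv h, fderiv_snd, add_comm]

lemma fderiv_comp_tangentLift (h : ContDiffAt ℝ ∞ ψ z.1) {f : E × E → V}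
    (hf : DifferentiableAt ℝ f (tangentLift ψ z)) (d : E × E) :
    fderiv ℝ (fun p => f (tangentLift ψ p)) z d = fderiv ℝ f (tangentLift ψ z)
      (fderiv ℝ ψ z.1 d.1, fderiv ℝ (fderiv ℝ ψ) z.1 d.1 z.2 + fderiv ℝ ψ z.1 d.2) := by
  rw [← fderiv_tangentLift h d]
  have := (hf.hasFDerivAt.comp z (differentiableAt_tangentLift h).hasFDerivAt).fderiv
  exact congrArg (fun T : E × E →L[ℝ] V => T d) this

lemma differentiableAt_comp_tangentLift (h : ContDiffAt ℝ ∞ ψ z.1) {f : E × E → V}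
    (hf : DifferentiableAt ℝ f (tangentLift ψ z)) :
    DifferentiableAt ℝ (fun p => f (tangentLift ψ p)) z :=
  hf.comp z (differentiableAt_tangentLift h)

lemma fderiv_fderiv_symm (h : ContDiffAt ℝ ∞ ψ z.1) (u w : E) :
    fderiv ℝ (fderiv ℝ ψ) z.1 u w = fderiv ℝ (fderiv ℝ ψ) z.1 w u :=
  (h.isSymmSndFDerivAt (by simpa using WithTop.coe_le_coe.2 (le_top : (2 : ℕ∞) ≤ ⊤))).eq u w

lemma fderiv_fderiv_fderiv_symm (h : ContDiffAt ℝ ∞ ψ z.1) (u w l : E) :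
    fderiv ℝ (fderiv ℝ (fderiv ℝ ψ)) z.1 u w l = fderiv ℝ (fderiv ℝ (fderiv ℝ ψ)) z.1 w u l := by
  have h1 := h.fderiv_right (m := ∞) le_rfl
  rw [(h1.isSymmSndFDerivAt (by simpa using WithTop.coe_le_coe.2 (le_top : (2 : ℕ∞) ≤ ⊤))).eq u w]

lemma contDiffAt' (h : IsCoordChange F F' ψ U) (hz : z ∈ U) : ContDiffAt ℝ ∞ F' z := by
  have h1 := ContDiffAt.comp z (h.contDiffAt_energy z hz)
    (contDiffAt_tangentLift (h.contDiffAt z hz))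
  refine h1.congr_of_eventuallyEq ?_
  filter_upwards [h.isOpen.mem_nhds hz] with p hp using h.eq p hp

lemma dDir_energy (h : IsCoordChange F F' ψ U) (hz : z ∈ U) (u : E) :
    dDir F' z u = dDir F (tangentLift ψ z) (fderiv ℝ ψ z.1 u) := by
  have h1 : F' =ᶠ[nhds z] fun p => F (tangentLift ψ p) := by
    filter_upwards [h.isOpen.mem_nhds hz] with p hp using h.eq p hp
  rw [dDir_apply, h1.fderiv_eq, fderiv_comp_tangentLift (h.contDiffAt z hz)
    ((h.contDiffAt_energy z hz).differentiableAt (by simp))]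
  simp [dDir_apply]

lemma dPos_energy (h : IsCoordChange F F' ψ U) (hz : z ∈ U) (u : E) :
    dPos F' z u = dPos F (tangentLift ψ z) (fderiv ℝ ψ z.1 u)
      + dDir F (tangentLift ψ z) (fderiv ℝ (fderiv ℝ ψ) z.1 u z.2) := by
  have h1 : F' =ᶠ[nhds z] fun p => F (tangentLift ψ p) := by
    filter_upwards [h.isOpen.mem_nhds hz] with p hp using h.eq p hp
  rw [dPos_apply, h1.fderiv_eq, fderiv_comp_tangentLift (h.contDiffAt z hz)
    ((h.contDiffAt_energy z hz).differentiableAt (by simp)), dPos_apply, dDir_apply, ← map_add]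
  simp

/-- Stated for an arbitrary direction `d` to serve twice: `d = (0, u)` gives the metric and `d = (y,
0)` the spray. -/
lemma fderiv_dDir_energy (h : IsCoordChange F F' ψ U) (hz : z ∈ U) (d : E × E) (w : E) :
    fderiv ℝ (dDir F') z d w = fderiv ℝ (dDir F) (tangentLift ψ z) (fderiv ℝ ψ z.1 d.1,
        fderiv ℝ (fderiv ℝ ψ) z.1 d.1 z.2 + fderiv ℝ ψ z.1 d.2) (fderiv ℝ ψ z.1 w)
      + dDir F (tangentLift ψ z) (fderiv ℝ (fderiv ℝ ψ) z.1 d.1 w) := by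
  have hψ := h.contDiffAt z hz
  have hd' : DifferentiableAt ℝ (dDir F') z :=
    (contDiffAt_dDir (h.contDiffAt' hz)).differentiableAt (by simp)
  have hd : DifferentiableAt ℝ (dDir F) (tangentLift ψ z) :=
    (contDiffAt_dDir (h.contDiffAt_energy z hz)).differentiableAt (by simp)
  have h1 : (fun p => dDir F' p w)
      =ᶠ[nhds z] fun p => dDir F (tangentLift ψ p) (fderiv ℝ ψ p.1 w) := by
    filter_upwards [h.isOpen.mem_nhds hz] with p hp using h.dDir_energy hp w
  have hJ := differentiableAt_fderiv hψ
  rw [← fderiv_apply hd', h1.fderiv_eq,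
    fderiv_clm_apply (differentiableAt_comp_tangentLift hψ hd)
      (hJ.clm_apply (differentiableAt_const w))]
  simp only [add_apply, ContinuousLinearMap.comp_apply, ContinuousLinearMap.flip_apply]
  rw [fderiv_apply hJ, fderiv_fderiv hψ, fderiv_comp_tangentLift hψ hd, add_comm]

lemma metric_eq (h : IsCoordChange F F' ψ U) (hz : z ∈ U) (u w : E) :
    metric F' z u w
      = metric F (tangentLift ψ z) (fderiv ℝ ψ z.1 u) (fderiv ℝ ψ z.1 w) := by
  rw [metric, dDir_apply, h.fderiv_dDir_energy hz]
  simp only [map_zero, zero_apply, zero_add, add_zero]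
  rfl

lemma isInvertible_metric' [FiniteDimensional ℝ E] (h : IsCoordChange F F' ψ U) (hz : z ∈ U) :
    (metric F' z).IsInvertible := by
  refine isInvertible_of_injective ((injective_iff_map_eq_zero _).2 fun u hu => ?_)
  apply (h.isInvertible z hz).injective
  apply (h.isInvertible_metric z hz).injective
  rw [map_zero, map_zero]
  ext w
  obtain ⟨w, rfl⟩ := (h.isInvertible z hz).surjective w
  rw [← h.metric_eq hz, hu]
  rfl

/-- Vectors of the new coordinates are identified by their products with the image of `Dψ`. -/
lemma eq_of_metric_eq (h : IsCoordChange F F' ψ U) (hz : z ∈ U) {u w : E}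
    (huw : ∀ l, metric F (tangentLift ψ z) u (fderiv ℝ ψ z.1 l)
      = metric F (tangentLift ψ z) w (fderiv ℝ ψ z.1 l)) : u = w := by
  apply (h.isInvertible_metric z hz).injective
  ext l
  obtain ⟨l, rfl⟩ := (h.isInvertible z hz).surjective l
  exact huw l

lemma differentiableAt_fderiv_fderiv_apply (h : ContDiffAt ℝ ∞ ψ z.1) (w : E) :
    DifferentiableAt ℝ (fun p : E × E => fderiv ℝ (fderiv ℝ ψ) p.1 w) z :=
  (differentiableAt_fderiv_fderiv h).clm_apply (differentiableAt_const w)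

lemma fderiv_fderiv_fderiv (h : ContDiffAt ℝ ∞ ψ z.1) (d : E × E) :
    fderiv ℝ (fun p : E × E => fderiv ℝ (fderiv ℝ ψ) p.1) z d
      = fderiv ℝ (fderiv ℝ (fderiv ℝ ψ)) z.1 d.1 :=
  fderiv_comp_fst (((h.fderiv_right (m := ∞) le_rfl).fderiv_right (m := ∞)
    le_rfl).differentiableAt (by simp)) d

lemma dHor_fderiv (hψ : ContDiffAt ℝ ∞ ψ z.1) (u : E) :
    dHor F' (fun p => fderiv ℝ ψ p.1) z u = fderiv ℝ (fderiv ℝ ψ) z.1 u := by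
  rw [dHor_apply, fderiv_fderiv hψ]

lemma dHor_fderiv_apply (hψ : ContDiffAt ℝ ∞ ψ z.1) (u w : E) :
    dHor F' (fun p => fderiv ℝ ψ p.1 w) z u = fderiv ℝ (fderiv ℝ ψ) z.1 u w := by
  rw [dHor_clm_apply (differentiableAt_fderiv hψ), dHor_fderiv hψ]

lemma differentiableAt_fderiv_apply (hψ : ContDiffAt ℝ ∞ ψ z.1) (w : E) :
    DifferentiableAt ℝ (fun p : E × E => fderiv ℝ ψ p.1 w) z :=
  (differentiableAt_fderiv hψ).clm_apply (differentiableAt_const w)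

lemma dDir_metric_eq (h : IsCoordChange F F' ψ U) (hz : z ∈ U) (u w l : E) :
    dDir (metric F') z u w l = dDir (metric F) (tangentLift ψ z) (fderiv ℝ ψ z.1 u)
        (fderiv ℝ ψ z.1 w) (fderiv ℝ ψ z.1 l) := by
  have hψ := h.contDiffAt z hz
  have hm' : DifferentiableAt ℝ (metric F') z :=
    (contDiffAt_metric (h.contDiffAt' hz)).differentiableAt (by simp)
  have hm : DifferentiableAt ℝ (metric F) (tangentLift ψ z) :=
    (contDiffAt_metric (h.contDiffAt_energy z hz)).differentiableAt (by simp)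
  have h1 : (fun p => metric F' p w l) =ᶠ[nhds z]
      fun p => metric F (tangentLift ψ p) (fderiv ℝ ψ p.1 w) (fderiv ℝ ψ p.1 l) := by
    filter_upwards [h.isOpen.mem_nhds hz] with p hp using h.metric_eq hp w l
  have hc := differentiableAt_comp_tangentLift hψ hm
  have hw := differentiableAt_fderiv_apply hψ w
  have hl := differentiableAt_fderiv_apply hψ l
  rw [dDir_apply, ← fderiv_apply hm', ← fderiv_apply (hm'.clm_apply (differentiableAt_const w)),
    h1.fderiv_eq, fderiv_clm_apply (hc.clm_apply hw) hl, fderiv_clm_apply hc hw]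
  simp only [add_apply, ContinuousLinearMap.comp_apply, ContinuousLinearMap.flip_apply,
    fderiv_apply (differentiableAt_fderiv hψ), fderiv_fderiv hψ, map_zero, zero_apply, zero_add,
    fderiv_comp_tangentLift hψ hm]
  rfl

variable [FiniteDimensional ℝ E]

/-- After pairing with the metric, the terms in `dDir F` applied to the Hessian of `ψ` cancel by
symmetry of the Hessian; the rest is half of `g(D²ψ(y, y), ·)`. -/
lemma spray_eq (h : IsCoordChange F F' ψ U) (hz : z ∈ U) :
    fderiv ℝ ψ z.1 (spray F' z) = spray F (tangentLift ψ z)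
      + (1 / 2 : ℝ) • fderiv ℝ (fderiv ℝ ψ) z.1 z.2 z.2 := by
  refine h.eq_of_metric_eq hz fun l => ?_
  have e : fderiv ℝ (dDir F) (tangentLift ψ z)
      (fderiv ℝ ψ z.1 z.2, fderiv ℝ (fderiv ℝ ψ) z.1 z.2 z.2)
      = dPos (dDir F) (tangentLift ψ z) (tangentLift ψ z).2
        + metric F (tangentLift ψ z) (fderiv ℝ (fderiv ℝ ψ) z.1 z.2 z.2) := by
    rw [metric, dPos_apply, dDir_apply, ← map_add]
    simp [tangentLift]
  have e2 := h.fderiv_dDir_energy hz (z.2, 0) l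
  simp only [map_zero, add_zero] at e2
  rw [e, ← dPos_apply] at e2
  rw [← h.metric_eq hz, spray, spray]
  simp only [map_smul, map_add, smul_apply, add_apply, metric_sharp (h.isInvertible_metric z hz),
    metric_sharp (h.isInvertible_metric' hz), sub_apply, e2, h.dPos_energy hz]
  rw [fderiv_fderiv_symm (h.contDiffAt z hz) l]
  simp only [smul_eq_mul]
  ring

/-- The vertical derivative of `spray_eq`; the symmetric quadratic term `D²ψ(y, y)` yields a factor
2 that absorbs the `1 / 2`. -/
lemma nonlin_eq (h : IsCoordChange F F' ψ U) (hz : z ∈ U) (u : E) :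
    fderiv ℝ ψ z.1 (nonlin F' z u) = nonlin F (tangentLift ψ z) (fderiv ℝ ψ z.1 u)
      + fderiv ℝ (fderiv ℝ ψ) z.1 u z.2 := by
  have : CompleteSpace E := FiniteDimensional.complete ℝ E
  have hψ := h.contDiffAt z hz
  have hS' : DifferentiableAt ℝ (spray F') z :=
    (contDiffAt_spray (h.contDiffAt' hz) (h.isInvertible_metric' hz)).differentiableAt (by simp)
  have hS : DifferentiableAt ℝ (spray F) (tangentLift ψ z) :=
    (contDiffAt_spray (h.contDiffAt_energy z hz) (h.isInvertible_metric z hz)).differentiableAt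
      (by simp)
  have h1 : (fun p => fderiv ℝ ψ p.1 (spray F' p)) =ᶠ[nhds z]
      fun p => spray F (tangentLift ψ p)
        + (1 / 2 : ℝ) • fderiv ℝ (fderiv ℝ ψ) p.1 p.2 p.2 := by
    filter_upwards [h.isOpen.mem_nhds hz] with p hp using h.spray_eq hp
  have h2 := congrArg (fun T : E × E →L[ℝ] E => T (0, u)) (h1.fderiv_eq (𝕜 := ℝ))
  have hJ := differentiableAt_fderiv hψ
  have hH := differentiableAt_fderiv_fderiv hψ
  have hH1 := hH.clm_apply differentiableAt_snd
  have hH2 := hH1.clm_apply differentiableAt_snd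
  rw [fderiv_clm_apply hJ hS', fderiv_fun_add (differentiableAt_comp_tangentLift hψ hS)
    (hH2.fun_const_smul (1 / 2 : ℝ)), fderiv_fun_const_smul hH2,
    fderiv_clm_apply hH1 differentiableAt_snd, fderiv_clm_apply hH differentiableAt_snd] at h2
  simp only [add_apply, ContinuousLinearMap.comp_apply, ContinuousLinearMap.flip_apply,
    smul_apply, fderiv_fderiv hψ, fderiv_fderiv_fderiv hψ, fderiv_snd,
    fderiv_comp_tangentLift hψ hS, map_zero, zero_apply, add_zero, zero_add,
    ContinuousLinearMap.coe_snd', fderiv_fderiv_symm hψ z.2 u, ← two_smul ℝ,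
    smul_smul] at h2
  norm_num at h2
  exact h2

/-- By `nonlin_eq` the differential of `tangentLift ψ` sends horizontal directions to horizontal
ones. -/
lemma dHor_comp_tangentLift (h : IsCoordChange F F' ψ U) (hz : z ∈ U) {f : E × E → V}
    (hf : DifferentiableAt ℝ f (tangentLift ψ z)) (u : E) :
    dHor F' (fun p => f (tangentLift ψ p)) z u
      = dHor F f (tangentLift ψ z) (fderiv ℝ ψ z.1 u) := by
  rw [dHor_apply, dHor_apply, fderiv_comp_tangentLift (h.contDiffAt z hz) hf]
  simp [h.nonlin_eq hz]

lemma dHor_metric_eq (h : IsCoordChange F F' ψ U) (hz : z ∈ U) (u w l : E) :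
    dHor F' (metric F') z u w l = dHor F (metric F) (tangentLift ψ z) (fderiv ℝ ψ z.1 u)
        (fderiv ℝ ψ z.1 w) (fderiv ℝ ψ z.1 l)
      + metric F (tangentLift ψ z) (fderiv ℝ (fderiv ℝ ψ) z.1 u w) (fderiv ℝ ψ z.1 l)
      + metric F (tangentLift ψ z) (fderiv ℝ ψ z.1 w) (fderiv ℝ (fderiv ℝ ψ) z.1 u l) := by
  have hψ := h.contDiffAt z hz
  have hm' : DifferentiableAt ℝ (metric F') z :=
    (contDiffAt_metric (h.contDiffAt' hz)).differentiableAt (by simp)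
  have hm : DifferentiableAt ℝ (metric F) (tangentLift ψ z) :=
    (contDiffAt_metric (h.contDiffAt_energy z hz)).differentiableAt (by simp)
  have h1 : (fun p => metric F' p w l) =ᶠ[nhds z]
      fun p => metric F (tangentLift ψ p) (fderiv ℝ ψ p.1 w) (fderiv ℝ ψ p.1 l) := by
    filter_upwards [h.isOpen.mem_nhds hz] with p hp using h.metric_eq hp w l
  have hc := differentiableAt_comp_tangentLift hψ hm
  have hw := differentiableAt_fderiv_apply hψ w
  rw [← dHor_clm_apply hm', ← dHor_clm_apply (hm'.clm_apply (differentiableAt_const w)),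
    dHor_congr h1, dHor_apply_of_differentiableAt (hc.clm_apply hw)
      (differentiableAt_fderiv_apply hψ l), dHor_apply_of_differentiableAt hc hw,
    h.dHor_comp_tangentLift hz hm, dHor_fderiv_apply hψ, dHor_fderiv_apply hψ, add_apply]

/-- The classical Christoffel law: in the combination of three derivatives of the metric all Hessian
terms cancel in pairs except two equal ones. -/
lemma horCoeff_eq (h : IsCoordChange F F' ψ U) (hz : z ∈ U) (u w : E) :
    fderiv ℝ ψ z.1 (horCoeff F' z u w)
      = horCoeff F (tangentLift ψ z) (fderiv ℝ ψ z.1 u) (fderiv ℝ ψ z.1 w)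
        + fderiv ℝ (fderiv ℝ ψ) z.1 u w := by
  have hψ := h.contDiffAt z hz
  have hs := metric_symm ((h.contDiffAt_energy z hz).of_le
    (WithTop.coe_le_coe.2 (le_top : (2 : ℕ∞) ≤ ⊤)))
  refine h.eq_of_metric_eq hz fun l => ?_
  rw [← h.metric_eq hz, metric_horCoeff (h.isInvertible_metric' hz), map_add, add_apply,
    metric_horCoeff (h.isInvertible_metric z hz), h.dHor_metric_eq hz, h.dHor_metric_eq hz,
    h.dHor_metric_eq hz, fderiv_fderiv_symm hψ w u, fderiv_fderiv_symm hψ l u,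
    fderiv_fderiv_symm hψ l w, hs (fderiv ℝ ψ z.1 w), hs (fderiv ℝ ψ z.1 u)]
  ring

lemma vertCoeff_eq (h : IsCoordChange F F' ψ U) (hz : z ∈ U) (u w : E) :
    fderiv ℝ ψ z.1 (vertCoeff F' z u w)
      = vertCoeff F (tangentLift ψ z) (fderiv ℝ ψ z.1 u) (fderiv ℝ ψ z.1 w) := by
  refine h.eq_of_metric_eq hz fun l => ?_
  rw [← h.metric_eq hz, metric_vertCoeff (h.isInvertible_metric' hz),
    metric_vertCoeff (h.isInvertible_metric z hz), h.dDir_metric_eq hz]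

lemma nonlinCurv_eq (h : IsCoordChange F F' ψ U) (hz : z ∈ U) (u w : E) :
    fderiv ℝ ψ z.1 (nonlinCurv F' z u w)
      = nonlinCurv F (tangentLift ψ z) (fderiv ℝ ψ z.1 u) (fderiv ℝ ψ z.1 w) := by
  have : CompleteSpace E := FiniteDimensional.complete ℝ E
  have hψ := h.contDiffAt z hz
  have hN' : DifferentiableAt ℝ (nonlin F') z :=
    (contDiffAt_nonlin (h.contDiffAt' hz) (h.isInvertible_metric' hz)).differentiableAt (by simp)
  have hN : DifferentiableAt ℝ (nonlin F) (tangentLift ψ z) :=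
    (contDiffAt_nonlin (h.contDiffAt_energy z hz) (h.isInvertible_metric z hz)).differentiableAt
      (by simp)
  -- The horizontal derivative of `nonlin_eq`. Apart from the two `dHor` terms, everything is
  -- symmetric in `u` and `w` and disappears on antisymmetrising.
  have key : ∀ u w : E, fderiv ℝ (fderiv ℝ ψ) z.1 u (nonlin F' z w)
      + fderiv ℝ ψ z.1 (dHor F' (nonlin F') z u w)
      = dHor F (nonlin F) (tangentLift ψ z) (fderiv ℝ ψ z.1 u) (fderiv ℝ ψ z.1 w)
      + nonlin F (tangentLift ψ z) (fderiv ℝ (fderiv ℝ ψ) z.1 u w)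
      + (fderiv ℝ (fderiv ℝ (fderiv ℝ ψ)) z.1 u w z.2
      - fderiv ℝ (fderiv ℝ ψ) z.1 w (nonlin F' z u)) := by
    intro u w
    have h1 : (fun p => fderiv ℝ ψ p.1 (nonlin F' p w)) =ᶠ[nhds z]
        fun p => nonlin F (tangentLift ψ p) (fderiv ℝ ψ p.1 w)
          + fderiv ℝ (fderiv ℝ ψ) p.1 w p.2 := by
      filter_upwards [h.isOpen.mem_nhds hz] with p hp using h.nonlin_eq hp w
    have h2 := congrArg (fun T : E →L[ℝ] E => T u) (dHor_congr (F := F') h1)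
    have hJ := differentiableAt_fderiv hψ
    have hw := differentiableAt_fderiv_apply hψ w
    have hH := differentiableAt_fderiv_fderiv_apply hψ w
    have hc := differentiableAt_comp_tangentLift hψ hN
    have h3 : dHor F' Prod.snd z u = -nonlin F' z u := by
      rw [dHor_apply, fderiv_snd]
      rfl
    have h4 : dHor F' (fun p : E × E => fderiv ℝ (fderiv ℝ ψ) p.1 w) z u
        = fderiv ℝ (fderiv ℝ (fderiv ℝ ψ)) z.1 u w := by
      rw [dHor_clm_apply (differentiableAt_fderiv_fderiv hψ), dHor_apply,
        fderiv_fderiv_fderiv hψ]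
    rw [dHor_apply_of_differentiableAt hJ (hN'.clm_apply (differentiableAt_const w)),
      dHor_add (hc.clm_apply hw) (hH.clm_apply differentiableAt_snd),
      dHor_apply_of_differentiableAt hc hw,
      dHor_apply_of_differentiableAt hH differentiableAt_snd, dHor_fderiv hψ,
      dHor_fderiv_apply hψ, dHor_clm_apply hN', h.dHor_comp_tangentLift hz hN, h3, h4,
      map_neg, ← sub_eq_add_neg] at h2
    exact h2
  have e : ∀ (F : E × E → ℝ) (z : E × E) (u w : E), nonlinCurv F z u w
      = dHor F (nonlin F) z u w - dHor F (nonlin F) z w u := fun _ _ _ _ => rfl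
  rw [e, e, map_sub]
  have h1 := key u w
  have h2 := key w u
  rw [fderiv_fderiv_symm hψ w u, fderiv_fderiv_fderiv_symm hψ w u] at h2
  linear_combination (norm := module) h1 - h2

lemma hCurv_eq (h : IsCoordChange F F' ψ U) (hz : z ∈ U) (X Y Z : E) :
    fderiv ℝ ψ z.1 (hCurv F' z X Y Z)
      = hCurv F (tangentLift ψ z) (fderiv ℝ ψ z.1 X) (fderiv ℝ ψ z.1 Y) (fderiv ℝ ψ z.1 Z) := by
  have : CompleteSpace E := FiniteDimensional.complete ℝ E
  have hψ := h.contDiffAt z hz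
  have hN' : DifferentiableAt ℝ (horCoeff F') z :=
    (contDiffAt_horCoeff (h.contDiffAt' hz) (h.isInvertible_metric' hz)).differentiableAt
      (by simp)
  have hN : DifferentiableAt ℝ (horCoeff F) (tangentLift ψ z) :=
    (contDiffAt_horCoeff (h.contDiffAt_energy z hz)
      (h.isInvertible_metric z hz)).differentiableAt (by simp)
  -- The horizontal derivative of `horCoeff_eq`. On antisymmetrising in `u` and `w`, the Hessian
  -- terms that are not symmetric cancel against those from the products of connection coefficients.
  have key : ∀ u w l : E, fderiv ℝ (fderiv ℝ ψ) z.1 u (horCoeff F' z w l)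
      + fderiv ℝ ψ z.1 (dHor F' (horCoeff F') z u w l)
      = dHor F (horCoeff F) (tangentLift ψ z) (fderiv ℝ ψ z.1 u) (fderiv ℝ ψ z.1 w)
        (fderiv ℝ ψ z.1 l)
      + horCoeff F (tangentLift ψ z) (fderiv ℝ (fderiv ℝ ψ) z.1 u w) (fderiv ℝ ψ z.1 l)
      + horCoeff F (tangentLift ψ z) (fderiv ℝ ψ z.1 w) (fderiv ℝ (fderiv ℝ ψ) z.1 u l)
      + fderiv ℝ (fderiv ℝ (fderiv ℝ ψ)) z.1 u w l := by
    intro u w l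
    have h1 : (fun p => fderiv ℝ ψ p.1 (horCoeff F' p w l)) =ᶠ[nhds z]
        fun p => horCoeff F (tangentLift ψ p) (fderiv ℝ ψ p.1 w) (fderiv ℝ ψ p.1 l)
          + fderiv ℝ (fderiv ℝ ψ) p.1 w l := by
      filter_upwards [h.isOpen.mem_nhds hz] with p hp using h.horCoeff_eq hp w l
    have h2 := congrArg (fun T : E →L[ℝ] E => T u) (dHor_congr (F := F') h1)
    have hJ := differentiableAt_fderiv hψ
    have hw := differentiableAt_fderiv_apply hψ w
    have hl := differentiableAt_fderiv_apply hψ l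
    have hH := differentiableAt_fderiv_fderiv_apply hψ w
    have hc := differentiableAt_comp_tangentLift hψ hN
    have hN1 := hN'.clm_apply (differentiableAt_const w)
    have h4 : dHor F' (fun p : E × E => fderiv ℝ (fderiv ℝ ψ) p.1 w l) z u
        = fderiv ℝ (fderiv ℝ (fderiv ℝ ψ)) z.1 u w l := by
      rw [dHor_clm_apply hH, dHor_clm_apply (differentiableAt_fderiv_fderiv hψ), dHor_apply,
        fderiv_fderiv_fderiv hψ]
    rw [dHor_apply_of_differentiableAt hJ (hN1.clm_apply (differentiableAt_const l)),
      dHor_add ((hc.clm_apply hw).clm_apply hl) (hH.clm_apply (differentiableAt_const l)),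
      dHor_apply_of_differentiableAt (hc.clm_apply hw) hl,
      dHor_apply_of_differentiableAt hc hw, dHor_fderiv hψ,
      dHor_fderiv_apply hψ, dHor_fderiv_apply hψ, dHor_clm_apply hN1, dHor_clm_apply hN',
      h.dHor_comp_tangentLift hz hN, h4, add_apply] at h2
    exact h2
  rw [hCurv_apply, hCurv_apply]
  simp only [map_neg, map_add, map_sub, h.horCoeff_eq hz, h.vertCoeff_eq hz,
    h.nonlinCurv_eq hz]
  have h1 := key X Y Z
  have h2 := key Y X Z
  rw [fderiv_fderiv_symm hψ Y X, fderiv_fderiv_fderiv_symm hψ Y X] at h2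
  linear_combination (norm := module) h2 - h1

lemma ricci_eq (h : IsCoordChange F F' ψ U) (hz : z ∈ U) (X Z : E) :
    ricci F' z X Z
      = ricci F (tangentLift ψ z) (fderiv ℝ ψ z.1 X) (fderiv ℝ ψ z.1 Z) := by
  rw [ricci_apply, ricci_apply]
  exact endTrace_eq_of_comp_eq (h.isInvertible z hz) fun u => h.hCurv_eq hz X u Z

/-- The scalar curvature does not depend on the coordinates. -/
theorem scalarCurv_eq (h : IsCoordChange F F' ψ U) (hz : z ∈ U) :
    scalarCurv F' z = scalarCurv F (tangentLift ψ z) := by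
  refine endTrace_eq_of_comp_eq (h.isInvertible z hz) fun u => h.eq_of_metric_eq hz fun l => ?_
  rw [← h.metric_eq hz, metric_ricciForm (h.isInvertible_metric' hz),
    metric_ricciForm (h.isInvertible_metric z hz), h.ricci_eq hz]

end IsCoordChange

end FinslerLocal

/-! ### From charts to the manifold: regularity, homogeneity, smoothness of `r`. -/

namespace Finsler

variable {E : Type*} [NormedAddCommGroup E] [NormedSpace ℝ E]
variable {M : Type*} [TopologicalSpace M] [ChartedSpace E M] [IsManifold 𝓘(ℝ, E) ∞ M]

/-! ### Charts of the tangent bundle -/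

lemma extChartAt_tangent_apply (v q : TangentBundle 𝓘(ℝ, E) M) :
    extChartAt 𝓘(ℝ, E).tangent v q = (extChartAt 𝓘(ℝ, E) v.proj q.proj,
      tangentCoordChange 𝓘(ℝ, E) q.proj v.proj q.proj q.snd) := rfl

lemma extChartAt_tangent_symm_apply (v : TangentBundle 𝓘(ℝ, E) M) (z : E × E) :
    (extChartAt 𝓘(ℝ, E).tangent v).symm z = ⟨(extChartAt 𝓘(ℝ, E) v.proj).symm z.1,
      tangentCoordChange 𝓘(ℝ, E) v.proj ((extChartAt 𝓘(ℝ, E) v.proj).symm z.1)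
        ((extChartAt 𝓘(ℝ, E) v.proj).symm z.1) z.2⟩ := rfl

lemma mem_extChartAt_tangent_target (v : TangentBundle 𝓘(ℝ, E) M) (z : E × E) :
    z ∈ (extChartAt 𝓘(ℝ, E).tangent v).target ↔ z.1 ∈ (extChartAt 𝓘(ℝ, E) v.proj).target := by
  rw [FiberBundle.extChartAt_target]
  simp +contextual [extChartAt]

lemma coords_eq (v : TangentBundle 𝓘(ℝ, E) M) :
    coords v = (extChartAt 𝓘(ℝ, E) v.proj v.proj, v.snd) :=
  Prod.ext rfl (tangentCoordChange_self (mem_extChartAt_source _))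

lemma coords_mk_smul (x : M) (y : TangentSpace 𝓘(ℝ, E) x) (c : ℝ) :
    coords (⟨x, c • y⟩ : TangentBundle 𝓘(ℝ, E) M)
      = ((coords (⟨x, y⟩ : TangentBundle 𝓘(ℝ, E) M)).1,
        c • (coords (⟨x, y⟩ : TangentBundle 𝓘(ℝ, E) M)).2) := by
  rw [coords_eq, coords_eq]
  rfl

lemma coords_fst_mem (v : TangentBundle 𝓘(ℝ, E) M) :
    (coords v).1 ∈ (extChartAt 𝓘(ℝ, E) v.proj).target :=
  mem_extChartAt_target v.proj

lemma coords_snd (v : TangentBundle 𝓘(ℝ, E) M) : (coords v).2 = v.snd := by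
  rw [coords_eq]

lemma tangentCoordChange_isInvertible {x y p : M} (hx : p ∈ (extChartAt 𝓘(ℝ, E) x).source)
    (hy : p ∈ (extChartAt 𝓘(ℝ, E) y).source) :
    (tangentCoordChange 𝓘(ℝ, E) x y p).IsInvertible :=
  ⟨ContinuousLinearEquiv.equivOfInverse (tangentCoordChange 𝓘(ℝ, E) x y p)
    (tangentCoordChange 𝓘(ℝ, E) y x p)
    (fun u => by rw [tangentCoordChange_comp ⟨⟨hx, hy⟩, hx⟩, tangentCoordChange_self hx])
    (fun u => by rw [tangentCoordChange_comp ⟨⟨hy, hx⟩, hy⟩, tangentCoordChange_self hy]), rfl⟩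

/-! ### The energy in a chart -/

variable {L : TangentBundle 𝓘(ℝ, E) M → ℝ}

lemma IsFinsler.contDiffAt_energy (hL : IsFinsler L) (v : TangentBundle 𝓘(ℝ, E) M) {z : E × E}
    (hz : z.1 ∈ (extChartAt 𝓘(ℝ, E) v.proj).target) (hy : z.2 ≠ 0) :
    ContDiffAt ℝ ∞ (energy L v) z := by
  have hz' := (mem_extChartAt_tangent_target v z).2 hz
  have h1 : ContMDiffAt 𝓘(ℝ, E × E) 𝓘(ℝ, E).tangent ∞ (extChartAt 𝓘(ℝ, E).tangent v).symm z :=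
    (contMDiffOn_extChartAt_symm v).contMDiffAt ((isOpen_extChartAt_target v).mem_nhds hz')
  -- The fibre coordinate change is invertible, so a nonzero coordinate vector represents a nonzero
  -- tangent vector.
  have hs : ((extChartAt 𝓘(ℝ, E).tangent v).symm z).snd ≠ 0 := by
    intro h0
    apply hy
    apply (tangentCoordChange_isInvertible ((extChartAt 𝓘(ℝ, E) v.proj).map_target hz)
      (mem_extChartAt_source ((extChartAt 𝓘(ℝ, E) v.proj).symm z.1))).injective
    rw [map_zero]
    exact h0
  have h2 : ContDiffAt ℝ ∞ (fun z => L ((extChartAt 𝓘(ℝ, E).tangent v).symm z)) z :=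
    contMDiffAt_iff_contDiffAt.1 ((hL.smooth _ hs).comp z h1)
  exact (h2.pow 2).div_const 2

lemma IsFinsler.contDiffAt_energy_coords (hL : IsFinsler L) {v : TangentBundle 𝓘(ℝ, E) M}
    (hv : v.snd ≠ 0) : ContDiffAt ℝ ∞ (energy L v) (coords v) :=
  hL.contDiffAt_energy v (coords_fst_mem v) (by rwa [coords_snd])

lemma IsFinsler.isHomogeneousOn_energy (hL : IsFinsler L) (v : TangentBundle 𝓘(ℝ, E) M)
    {c : ℝ} (hc : 0 < c) : FinslerLocal.IsHomogeneousOn (extChartAt 𝓘(ℝ, E) v.proj).target c 2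
      (energy L v) := by
  intro z _
  have h := hL.homogeneous _ ((extChartAt 𝓘(ℝ, E).tangent v).symm z).snd c hc
  have e : (extChartAt 𝓘(ℝ, E).tangent v).symm (z.1, c • z.2)
      = ⟨((extChartAt 𝓘(ℝ, E).tangent v).symm z).proj,
        c • ((extChartAt 𝓘(ℝ, E).tangent v).symm z).snd⟩ := by
    rw [extChartAt_tangent_symm_apply, map_smul]
    rfl
  unfold energy
  rw [e, h, zpow_ofNat, smul_eq_mul]
  ring

lemma IsFinsler.isInvertible_metric [FiniteDimensional ℝ E] (hL : IsFinsler L)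
    {v : TangentBundle 𝓘(ℝ, E) M} (hv : v.snd ≠ 0) :
    (FinslerLocal.metric (energy L v) (coords v)).IsInvertible := by
  refine FinslerLocal.isInvertible_of_injective ((injective_iff_map_eq_zero _).2 fun u hu => ?_)
  by_contra h0
  have h1 : 0 < FinslerLocal.metric (energy L v) (coords v) u u := hL.metric_pos v hv u h0
  rw [hu] at h1
  exact lt_irrefl _ h1

/-! ### Invariance under scaling of the tangent vector -/

section Scaling

/-- Vectors on one ray share their base point, hence the chart and the local energy; only the second
coordinate is scaled. The next lemmas rest on the same remark. -/
lemma IsFinsler.tensorG_smul (hL : IsFinsler L) (x : M) (y : TangentSpace 𝓘(ℝ, E) x) {c : ℝ}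
    (hc : 0 < c) (X Y Z W : TangentSpace 𝓘(ℝ, E) x) :
    tensorG L ⟨x, c • y⟩ X Y Z W = tensorG L ⟨x, y⟩ X Y Z W := by
  unfold tensorG
  rw [coords_mk_smul]
  exact FinslerLocal.tensorG_smul (hL.isHomogeneousOn_energy ⟨x, y⟩ hc)
    (isOpen_extChartAt_target x) hc.ne' (coords_fst_mem _) X Y Z W

variable [FiniteDimensional ℝ E]

lemma IsFinsler.scalarCurv_smul (hL : IsFinsler L) (x : M) (y : TangentSpace 𝓘(ℝ, E) x) {c : ℝ}
    (hc : 0 < c) : scalarCurv L ⟨x, c • y⟩ = scalarCurv L ⟨x, y⟩ := by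
  unfold scalarCurv
  rw [coords_mk_smul]
  exact FinslerLocal.scalarCurv_smul (hL.isHomogeneousOn_energy ⟨x, y⟩ hc)
    (isOpen_extChartAt_target x) hc.ne' (coords_fst_mem _)

lemma IsFinsler.conharmonic_smul (hL : IsFinsler L) (x : M) (y : TangentSpace 𝓘(ℝ, E) x) {c : ℝ}
    (hc : 0 < c) (X Y Z W : TangentSpace 𝓘(ℝ, E) x) :
    conharmonic L ⟨x, c • y⟩ X Y Z W = conharmonic L ⟨x, y⟩ X Y Z W := by
  unfold conharmonic
  rw [coords_mk_smul]
  exact FinslerLocal.conharmonic_smul (hL.isHomogeneousOn_energy ⟨x, y⟩ hc)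
    (isOpen_extChartAt_target x) hc.ne' (coords_fst_mem _) X Y Z W

lemma IsFinsler.hCovConharmonic_smul (hL : IsFinsler L) (x : M) (y : TangentSpace 𝓘(ℝ, E) x)
    {c : ℝ} (hc : 0 < c) (U X Y Z W : TangentSpace 𝓘(ℝ, E) x) :
    hCovConharmonic L ⟨x, c • y⟩ U X Y Z W = hCovConharmonic L ⟨x, y⟩ U X Y Z W := by
  have hh := hL.isHomogeneousOn_energy ⟨x, y⟩ hc
  unfold hCovConharmonic
  rw [coords_mk_smul]
  exact FinslerLocal.hCov_smul hh (isOpen_extChartAt_target x) hc.ne' (coords_fst_mem _)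
    (fun z hz => FinslerLocal.conharmonic_smul hh (isOpen_extChartAt_target x) hc.ne' hz)
    U X Y Z W

end Scaling

/-! ### Smoothness of the scalar curvature -/

/-- Transition maps of `TM` are the tangent lifts of transition maps of `M`, which is what makes
`IsCoordChange` applicable. -/
lemma extChartAt_tangent_symm_trans (v v₀ : TangentBundle 𝓘(ℝ, E) M) {z : E × E}
    (hz : z.1 ∈ (extChartAt 𝓘(ℝ, E) v.proj).target)
    (hz₀ : (extChartAt 𝓘(ℝ, E) v.proj).symm z.1 ∈ (extChartAt 𝓘(ℝ, E) v₀.proj).source) :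
    fderiv ℝ (extChartAt 𝓘(ℝ, E) v₀.proj ∘ (extChartAt 𝓘(ℝ, E) v.proj).symm) z.1
        = tangentCoordChange 𝓘(ℝ, E) v.proj v₀.proj ((extChartAt 𝓘(ℝ, E) v.proj).symm z.1) ∧
    extChartAt 𝓘(ℝ, E).tangent v₀ ((extChartAt 𝓘(ℝ, E).tangent v).symm z)
      = FinslerLocal.tangentLift
        (extChartAt 𝓘(ℝ, E) v₀.proj ∘ (extChartAt 𝓘(ℝ, E) v.proj).symm) z := by
  have h1 : fderiv ℝ (extChartAt 𝓘(ℝ, E) v₀.proj ∘ (extChartAt 𝓘(ℝ, E) v.proj).symm) z.1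
      = tangentCoordChange 𝓘(ℝ, E) v.proj v₀.proj
        ((extChartAt 𝓘(ℝ, E) v.proj).symm z.1) := by
    rw [tangentCoordChange_def, (extChartAt 𝓘(ℝ, E) v.proj).right_inv hz,
      modelWithCornersSelf_coe, Set.range_id, fderivWithin_univ]
  refine ⟨h1, ?_⟩
  rw [extChartAt_tangent_symm_apply, extChartAt_tangent_apply, FinslerLocal.tangentLift, h1]
  refine Prod.ext rfl ?_
  exact tangentCoordChange_comp ⟨⟨(extChartAt 𝓘(ℝ, E) v.proj).map_target hz,
    mem_extChartAt_source _⟩, hz₀⟩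

variable [FiniteDimensional ℝ E]

/-- The points of the chart at `v` with nonzero directional argument and invertible metric. -/
def regularSet (L : TangentBundle 𝓘(ℝ, E) M → ℝ) (v : TangentBundle 𝓘(ℝ, E) M) : Set (E × E) :=
  {z | z.1 ∈ (extChartAt 𝓘(ℝ, E) v.proj).target ∧ z.2 ≠ 0} ∩
    FinslerLocal.metric (energy L v) ⁻¹' {T | T.IsInvertible}

lemma IsFinsler.isOpen_regularSet (hL : IsFinsler L) (v : TangentBundle 𝓘(ℝ, E) M) :
    IsOpen (regularSet L v) := by
  have : CompleteSpace E := FiniteDimensional.complete ℝ E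
  refine ContinuousOn.isOpen_inter_preimage ?_ ?_ ContinuousLinearEquiv.isOpen
  · intro z hz
    exact (FinslerLocal.contDiffAt_metric
      (hL.contDiffAt_energy v hz.1 hz.2)).continuousAt.continuousWithinAt
  · exact ((isOpen_extChartAt_target v.proj).preimage continuous_fst).inter
      (isOpen_ne.preimage continuous_snd)

lemma IsFinsler.isCoordChange (hL : IsFinsler L) (v v₀ : TangentBundle 𝓘(ℝ, E) M) :
    FinslerLocal.IsCoordChange (energy L v₀) (energy L v)
      (extChartAt 𝓘(ℝ, E) v₀.proj ∘ (extChartAt 𝓘(ℝ, E) v.proj).symm)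
      ((Prod.fst ⁻¹' ((extChartAt 𝓘(ℝ, E) v.proj).target ∩
          (extChartAt 𝓘(ℝ, E) v.proj).symm ⁻¹' (extChartAt 𝓘(ℝ, E) v₀.proj).source)) ∩
        FinslerLocal.tangentLift
          (extChartAt 𝓘(ℝ, E) v₀.proj ∘ (extChartAt 𝓘(ℝ, E) v.proj).symm) ⁻¹'
          regularSet L v₀) := by
  have hS : IsOpen ((extChartAt 𝓘(ℝ, E) v.proj).target ∩
      (extChartAt 𝓘(ℝ, E) v.proj).symm ⁻¹' (extChartAt 𝓘(ℝ, E) v₀.proj).source) :=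
    (continuousOn_extChartAt_symm v.proj).isOpen_inter_preimage
      (isOpen_extChartAt_target v.proj) (isOpen_extChartAt_source v₀.proj)
  have hψ : ∀ x ∈ (extChartAt 𝓘(ℝ, E) v.proj).target ∩
      (extChartAt 𝓘(ℝ, E) v.proj).symm ⁻¹' (extChartAt 𝓘(ℝ, E) v₀.proj).source,
      ContDiffAt ℝ ∞ (extChartAt 𝓘(ℝ, E) v₀.proj ∘ (extChartAt 𝓘(ℝ, E) v.proj).symm) x := by
    intro x hx
    have := contDiffWithinAt_ext_coord_change (I := 𝓘(ℝ, E)) (n := ∞) v₀.proj v.proj hx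
    rwa [modelWithCornersSelf_coe, Set.range_id, contDiffWithinAt_univ] at this
  refine ⟨?_, fun z hz => hψ _ hz.1, fun z hz => ?_,
    fun z hz => hL.contDiffAt_energy v₀ hz.2.1.1 hz.2.1.2, fun z hz => hz.2.2, fun z hz => ?_⟩
  · refine ContinuousOn.isOpen_inter_preimage (fun z hz => ?_) (hS.preimage continuous_fst)
      (hL.isOpen_regularSet v₀)
    exact (FinslerLocal.IsCoordChange.contDiffAt_tangentLift
      (hψ _ hz)).continuousAt.continuousWithinAt
  · rw [(extChartAt_tangent_symm_trans v v₀ hz.1.1 hz.1.2).1]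
    exact tangentCoordChange_isInvertible ((extChartAt 𝓘(ℝ, E) v.proj).map_target hz.1.1) hz.1.2
  · unfold energy
    rw [← (extChartAt_tangent_symm_trans v v₀ hz.1.1 hz.1.2).2,
      (extChartAt 𝓘(ℝ, E).tangent v₀).left_inv]
    rw [extChartAt_source, TangentBundle.mem_chart_source_iff, ← extChartAt_source 𝓘(ℝ, E)]
    exact hz.1.2

/-- The horizontal scalar curvature is a smooth function on the bundle of nonzero vectors. -/
theorem IsFinsler.contMDiffAt_scalarCurv (hL : IsFinsler L) {v₀ : TangentBundle 𝓘(ℝ, E) M}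
    (hv₀ : v₀.snd ≠ 0) :
    ContMDiffAt 𝓘(ℝ, E).tangent 𝓘(ℝ, ℝ) ∞ (fun v => scalarCurv L v) v₀ := by
  have hmem : extChartAt 𝓘(ℝ, E).tangent v₀ v₀ ∈ regularSet L v₀ :=
    ⟨⟨coords_fst_mem v₀, by rw [← coords, coords_snd]; exact hv₀⟩, hL.isInvertible_metric hv₀⟩
  have h1 : ContMDiffAt 𝓘(ℝ, E).tangent 𝓘(ℝ, ℝ) ∞
      (fun v => FinslerLocal.scalarCurv (energy L v₀) (extChartAt 𝓘(ℝ, E).tangent v₀ v)) v₀ := by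
    have h2 := FinslerLocal.contDiffAt_scalarCurv (hL.contDiffAt_energy_coords hv₀)
      (hL.isInvertible_metric hv₀)
    exact ContMDiffAt.comp (g := fun p => FinslerLocal.scalarCurv (energy L v₀) p) v₀
      (contMDiffAt_iff_contDiffAt.2 h2) contMDiffAt_extChartAt
  -- In the fixed chart at `v₀` smoothness is clear. Coordinate invariance identifies that function,
  -- near `v₀`, with the one computed in the chart of each `v`.
  refine h1.congr_of_eventuallyEq ?_
  have h3 := (continuousAt_extChartAt (I := 𝓘(ℝ, E).tangent) v₀).preimage_mem_nhds
    ((hL.isOpen_regularSet v₀).mem_nhds hmem)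
  filter_upwards [h3, extChartAt_source_mem_nhds (I := 𝓘(ℝ, E).tangent) v₀] with v hv hs
  have hs' : v.proj ∈ (extChartAt 𝓘(ℝ, E) v₀.proj).source := by
    rw [extChartAt_source, TangentBundle.mem_chart_source_iff] at hs
    rwa [extChartAt_source]
  have hz₀ : (extChartAt 𝓘(ℝ, E) v.proj).symm (coords v).1
      ∈ (extChartAt 𝓘(ℝ, E) v₀.proj).source := by
    rw [coords_eq, extChartAt_to_inv]
    exact hs'
  have e := (extChartAt_tangent_symm_trans v v₀ (coords_fst_mem v) hz₀).2
  rw [coords, extChartAt_to_inv, ← coords] at e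
  rw [scalarCurv, (hL.isCoordChange v v₀).scalarCurv_eq ⟨⟨coords_fst_mem v, hz₀⟩, ?_⟩, ← e]
  rw [Set.mem_preimage, ← e]
  exact hv

end Finsler

/-! ### Making the recurrence forms homogeneous, and the conclusion. -/

namespace Finsler

variable {E : Type*} [NormedAddCommGroup E] [NormedSpace ℝ E]
variable {M : Type*} [TopologicalSpace M] [ChartedSpace E M] [IsManifold 𝓘(ℝ, E) ∞ M]
variable {L : TangentBundle 𝓘(ℝ, E) M → ℝ}

/-! ### Rescaled and averaged forms -/

/-- The value of the form at the multiple of `v` on which `L` takes the value `c`. -/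
noncomputable def PiForm.rescale (A : PiForm E M) (L : TangentBundle 𝓘(ℝ, E) M → ℝ) (c : ℝ) :
    PiForm E M :=
  fun v => A ⟨v.proj, (c / L v) • v.snd⟩

/-- The type of `A v` depends on `v`; fixing the base point `x` lets equal vectors be exchanged. -/
lemma PiForm.apply_mk_congr (A : PiForm E M) {x : M} {y y' : TangentSpace 𝓘(ℝ, E) x}
    (h : y = y') : (A ⟨x, y⟩ : TangentSpace 𝓘(ℝ, E) x →L[ℝ] ℝ) = A ⟨x, y'⟩ := by
  subst h
  rfl

lemma PiForm.rescale_apply_self (A : PiForm E M) {v : TangentBundle 𝓘(ℝ, E) M} (hv : 0 < L v) :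
    A.rescale L (L v) v = A v := by
  refine A.apply_mk_congr (y' := v.snd) ?_
  rw [div_self hv.ne', one_smul]

lemma IsFinsler.isNonzero_rescale (hL : IsFinsler L) {A : PiForm E M} (hA : A.IsNonzero) :
    ∃ c : ℝ, 0 < c ∧ (A.rescale L c).IsNonzero := by
  obtain ⟨v, hv, hAv⟩ := hA
  -- The level of `L` through a point where `A` does not vanish: there rescaling leaves the value
  -- unchanged.
  exact ⟨L v, hL.pos v hv, v, hv, by rwa [A.rescale_apply_self (hL.pos v hv)]⟩

lemma IsFinsler.isHomogeneous_rescale (hL : IsFinsler L) (A : PiForm E M) (c : ℝ) :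
    (A.rescale L c).IsHomogeneous := by
  intro x y t _ ht
  refine A.apply_mk_congr ?_
  change (c / L ⟨x, t • y⟩) • t • y = (c / L ⟨x, y⟩) • y
  rw [hL.homogeneous x y t ht, smul_smul]
  congr 1
  rw [mul_comm t, ← div_div, div_mul_cancel₀ _ ht.ne']

lemma IsFinsler.contMDiffAt_smul_snd (hL : IsFinsler L) (c : ℝ) {v₀ : TangentBundle 𝓘(ℝ, E) M}
    (hv₀ : v₀.snd ≠ 0) : ContMDiffAt 𝓘(ℝ, E).tangent 𝓘(ℝ, E).tangent ∞
      (fun v : TangentBundle 𝓘(ℝ, E) M =>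
        (⟨v.proj, (c / L v) • v.snd⟩ : TangentBundle 𝓘(ℝ, E) M)) v₀ := by
  have h := (Bundle.contMDiffAt_totalSpace (n := ∞) (F := E)
    (E := (TangentSpace 𝓘(ℝ, E) : M → Type _))).1
    (contMDiffAt_id (I := 𝓘(ℝ, E).tangent) (x := v₀))
  refine Bundle.contMDiffAt_totalSpace.2 ⟨h.1, ?_⟩
  have h1 : ContMDiffAt 𝓘(ℝ, E).tangent 𝓘(ℝ, ℝ) ∞ (fun v => c / L v) v₀ :=
    contMDiffAt_const.div₀ (hL.smooth v₀ hv₀) (hL.pos v₀ hv₀).ne'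
  refine (h1.smul h.2).congr_of_eventuallyEq (Filter.Eventually.of_forall fun v => ?_)
  exact map_smul (tangentCoordChange 𝓘(ℝ, E) v.proj v₀.proj v.proj) (c / L v) v.snd

lemma IsFinsler.isSmooth_rescale (hL : IsFinsler L) {A : PiForm E M} (hA : A.IsSmooth)
    {c : ℝ} (hc : 0 < c) : (A.rescale L c).IsSmooth := by
  intro v₀ hv₀ u
  have h := hA ⟨v₀.proj, (c / L v₀) • v₀.snd⟩
    (smul_ne_zero (div_pos hc (hL.pos v₀ hv₀)).ne' hv₀) u
  exact ContMDiffAt.comp v₀ h (hL.contMDiffAt_smul_snd c hv₀)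

/-- The average of two forms. -/
noncomputable def PiForm.average (A B : PiForm E M) : PiForm E M :=
  fun v => (1 / 2 : ℝ) • (A v + B v)

lemma PiForm.IsSmooth.average {A B : PiForm E M} (hA : A.IsSmooth) (hB : B.IsSmooth) :
    (A.average B).IsSmooth := by
  intro v₀ hv₀ u
  exact (contMDiffAt_const (c := (1 / 2 : ℝ))).mul ((hA v₀ hv₀ u).add (hB v₀ hv₀ u))

lemma PiForm.IsHomogeneous.average {A B : PiForm E M} (hA : A.IsHomogeneous)
    (hB : B.IsHomogeneous) : (A.average B).IsHomogeneous := by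
  intro x y c hy hc
  change (1 / 2 : ℝ) • (A ⟨x, c • y⟩ + B ⟨x, c • y⟩) = (1 / 2 : ℝ) • (A ⟨x, y⟩ + B ⟨x, y⟩)
  exact congrArg₂ (fun a b : TangentSpace 𝓘(ℝ, E) x →L[ℝ] ℝ => (1 / 2 : ℝ) • (a + b))
    (hA x y c hy hc) (hB x y c hy hc)

lemma PiForm.IsNonzero.average_left {A B : PiForm E M} (hA : A.IsNonzero)
    (hB : ¬ B.IsNonzero) : (A.average B).IsNonzero := by
  obtain ⟨v, hv, hAv⟩ := hA
  refine ⟨v, hv, ?_⟩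
  have hBv : B v = 0 := by
    by_contra h
    exact hB ⟨v, hv, h⟩
  simp [PiForm.average, hBv, hAv]

lemma PiForm.IsNonzero.average_right {A B : PiForm E M} (hB : B.IsNonzero)
    (hA : ¬ A.IsNonzero) : (A.average B).IsNonzero := by
  obtain ⟨v, hv, hBv⟩ := hB
  refine ⟨v, hv, ?_⟩
  have hAv : A v = 0 := by
    by_contra h
    exact hA ⟨v, hv, h⟩
  simp [PiForm.average, hBv, hAv]

variable [FiniteDimensional ℝ E]

/-- The equation is affine in the pair of forms, so its solutions are closed under midpoints. -/
lemma GeneralizedConharmonicRecurrence.average {A A' B B' : PiForm E M}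
    (h : GeneralizedConharmonicRecurrence L A B) (h' : GeneralizedConharmonicRecurrence L A' B') :
    GeneralizedConharmonicRecurrence L (A.average A') (B.average B') := by
  intro v hv U X Y Z W
  change _ = (1 / 2 : ℝ) * (A v U + A' v U) * _ + (1 / 2 : ℝ) * (B v U + B' v U) * _
  linear_combination (1 / 2 : ℝ) * h v hv U X Y Z W + (1 / 2 : ℝ) * h' v hv U X Y Z W

/-- The equation is read at the multiple of `v` on the level `c`; the three tensors take the same
values there as at `v`. -/
lemma IsFinsler.generalizedConharmonicRecurrence_rescale (hL : IsFinsler L) {A B : PiForm E M}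
    (h : GeneralizedConharmonicRecurrence L A B) {c : ℝ} (hc : 0 < c) :
    GeneralizedConharmonicRecurrence L (A.rescale L c) (B.rescale L c) := by
  rintro ⟨x, y⟩ hv U X Y Z W
  have hk : 0 < c / L ⟨x, y⟩ := div_pos hc (hL.pos _ hv)
  have h1 := h ⟨x, (c / L ⟨x, y⟩) • y⟩ (smul_ne_zero hk.ne' hv) U X Y Z W
  rw [hL.hCovConharmonic_smul x y hk, hL.conharmonic_smul x y hk, hL.tensorG_smul x y hk] at h1
  exact h1

lemma IsFinsler.conharmonicRecurrence_rescale (hL : IsFinsler L) {A : PiForm E M}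
    (h : ConharmonicRecurrence L A) {c : ℝ} (hc : 0 < c) :
    ConharmonicRecurrence L (A.rescale L c) := by
  rintro ⟨x, y⟩ hv U X Y Z W
  have hk : 0 < c / L ⟨x, y⟩ := div_pos hc (hL.pos _ hv)
  have h1 := h ⟨x, (c / L ⟨x, y⟩) • y⟩ (smul_ne_zero hk.ne' hv) U X Y Z W
  rw [hL.hCovConharmonic_smul x y hk, hL.conharmonic_smul x y hk] at h1
  exact h1

/-- A recurrence equation with nonzero forms admits nonzero homogeneous forms. -/
lemma IsFinsler.exists_homogeneous_forms (hL : IsFinsler L) {A B : PiForm E M}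
    (hA : A.IsSmooth) (hB : B.IsSmooth) (hA0 : A.IsNonzero) (hB0 : B.IsNonzero)
    (h : GeneralizedConharmonicRecurrence L A B) :
    ∃ A' B' : PiForm E M, A'.IsSmooth ∧ A'.IsNonzero ∧ A'.IsHomogeneous ∧
      B'.IsSmooth ∧ B'.IsNonzero ∧ B'.IsHomogeneous ∧
      GeneralizedConharmonicRecurrence L A' B' := by
  obtain ⟨a, ha, hAa⟩ := hL.isNonzero_rescale hA0
  obtain ⟨b, hb, hBb⟩ := hL.isNonzero_rescale hB0
  have hAs := fun c (hc : 0 < c) => hL.isSmooth_rescale hA hc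
  have hBs := fun c (hc : 0 < c) => hL.isSmooth_rescale hB hc
  have hAh := hL.isHomogeneous_rescale A
  have hBh := hL.isHomogeneous_rescale B
  have hr := fun c (hc : 0 < c) => hL.generalizedConharmonicRecurrence_rescale h hc
  -- `A` and `B` may be nonzero only on different levels of `L`. If neither level serves both forms,
  -- then `B` rescaled to `a` and `A` rescaled to `b` vanish, so in the mean of the two pairs
  -- neither form is cancelled.
  by_cases hBa : (B.rescale L a).IsNonzero
  · exact ⟨_, _, hAs a ha, hAa, hAh a, hBs a ha, hBa, hBh a, hr a ha⟩
  by_cases hAb : (A.rescale L b).IsNonzero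
  · exact ⟨_, _, hAs b hb, hAb, hAh b, hBs b hb, hBb, hBh b, hr b hb⟩
  exact ⟨_, _, (hAs a ha).average (hAs b hb), hAa.average_left hAb, (hAh a).average (hAh b),
    (hBs a ha).average (hBs b hb), hBb.average_right hBa, (hBh a).average (hBh b),
    (hr a ha).average (hr b hb)⟩

/-! ### Hyper-generalized recurrent manifolds -/

/-- The second recurrence form `- (2 r / (n - 2)) B` of the conharmonic curvature tensor. -/
noncomputable def conharmonicForm (L : TangentBundle 𝓘(ℝ, E) M → ℝ) (B : PiForm E M) :
    PiForm E M :=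
  fun v => (-(2 / ((Module.finrank ℝ E : ℝ) - 2)) * scalarCurv L v) • B v

variable {A B : PiForm E M}

lemma IsHyperGeneralizedRecurrent.finrank_sub_two_pos (h : IsHyperGeneralizedRecurrent L A B) :
    0 < (Module.finrank ℝ E : ℝ) - 2 := by
  have h3 : (3 : ℝ) ≤ Module.finrank ℝ E := by exact_mod_cast h.dim
  linarith

lemma IsHyperGeneralizedRecurrent.generalizedConharmonicRecurrence
    (h : IsHyperGeneralizedRecurrent L A B) :
    GeneralizedConharmonicRecurrence L A (conharmonicForm L B) := fun v hv U =>
  FinslerLocal.hCov_conharmonic_of_recurrence h.finrank_sub_two_pos.ne'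
    (h.finsler.contDiffAt_energy_coords hv) (h.finsler.isInvertible_metric hv)
    (h.recurrence v hv U)

lemma IsFinsler.isSmooth_conharmonicForm (hL : IsFinsler L) (hB : B.IsSmooth) :
    (conharmonicForm L B).IsSmooth := by
  intro v₀ hv₀ u
  exact (contMDiffAt_const.mul (hL.contMDiffAt_scalarCurv hv₀)).mul (hB v₀ hv₀ u)

lemma IsFinsler.isHomogeneous_conharmonicForm (hL : IsFinsler L) (hB : B.IsHomogeneous) :
    (conharmonicForm L B).IsHomogeneous := by
  intro x y c hy hc
  have h1 := hB x y c hy hc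
  unfold conharmonicForm
  rw [hL.scalarCurv_smul x y hc, h1]

lemma IsHyperGeneralizedRecurrent.conharmonicForm_eq_zero_iff
    (h : IsHyperGeneralizedRecurrent L A B) {v : TangentBundle 𝓘(ℝ, E) M}
    (hr : scalarCurv L v ≠ 0) : conharmonicForm L B v = 0 ↔ B v = 0 := by
  have hn := h.finrank_sub_two_pos
  have h2 : -(2 / ((Module.finrank ℝ E : ℝ) - 2)) ≠ 0 := neg_ne_zero.2 (by positivity)
  unfold conharmonicForm
  rw [smul_eq_zero, or_iff_right (mul_ne_zero h2 hr)]

end Finsler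

end

theorem theorem3p3 {E : Type*} [NormedAddCommGroup E] [NormedSpace ℝ E] [FiniteDimensional ℝ E]
    {M : Type*} [TopologicalSpace M] [ChartedSpace E M] [IsManifold 𝓘(ℝ, E) ∞ M]
    (L : TangentBundle 𝓘(ℝ, E) M → ℝ) (A B : Finsler.PiForm E M)
    (hL : Finsler.IsHyperGeneralizedRecurrent L A B) :
    ((∀ v : TangentBundle 𝓘(ℝ, E) M, v.snd ≠ 0 → Finsler.scalarCurv L v ≠ 0) →
      Finsler.IsGeneralizedConharmonicallyRecurrent L ∧
      ∃ B' : Finsler.PiForm E M, B'.IsSmooth ∧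
        (∀ v : TangentBundle 𝓘(ℝ, E) M, v.snd ≠ 0 → (B' v = 0 ↔ B v = 0)) ∧
        (B.IsHomogeneous → B'.IsHomogeneous) ∧
        Finsler.GeneralizedConharmonicRecurrence L A B') ∧
    ((∀ v : TangentBundle 𝓘(ℝ, E) M, v.snd ≠ 0 → Finsler.scalarCurv L v = 0) →
      Finsler.IsConharmonicallyRecurrent L ∧ Finsler.ConharmonicRecurrence L A) := by
  have hF := hL.finsler
  have hrec := hL.generalizedConharmonicRecurrence
  constructor
  · intro hr
    have hs := hF.isSmooth_conharmonicForm hL.smooth_B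
    have h0 := fun v hv => hL.conharmonicForm_eq_zero_iff (hr v hv)
    obtain ⟨v, hv, hBv⟩ := hL.nonzero_B
    exact ⟨⟨hF, hL.dim, hL.curv, hF.exists_homogeneous_forms hL.smooth_A hs hL.nonzero_A
      ⟨v, hv, fun h => hBv ((h0 v hv).1 h)⟩ hrec⟩, _, hs, h0,
      hF.isHomogeneous_conharmonicForm, hrec⟩
  · intro hr
    have hC : Finsler.ConharmonicRecurrence L A := by
      intro v hv U X Y Z W
      have h := hrec v hv U X Y Z W
      -- The coefficient of `𝐆` carries the factor `r`.
      simpa [Finsler.conharmonicForm, hr v hv] using h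
    obtain ⟨c, hc, hA⟩ := hF.isNonzero_rescale hL.nonzero_A
    exact ⟨⟨hF, hL.dim, hL.curv, _, hF.isSmooth_rescale hL.smooth_A hc, hA,
      hF.isHomogeneous_rescale A c, hF.conharmonicRecurrence_rescale hC hc⟩, hC⟩
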